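/- **Theorem 3.** Let $b>0$, $\omega>0$, and let $H_C=-\Delta-b/|x|$ on $H^2(\mathbb R^3)$. Write $B_r=\{x\in\mathbb R^3:|x|<r\}$ and let $\chi_A$ denote the characteristic function of $A$. Let $V(t,x)=\sum_{j\in\mathbb Z}\Omega_j(x)e^{ij\omega t}$ be real valued with $\Omega_0\equiv 0$, where the $\Omega_j$ vanish outside the closed unit ball, are smooth inside $B_1$, and satisfy $\sum_{j}(1+|j|)\,\|\Omega_j\|_{L^\infty(B_1)}<\infty$. Let $p_1\in\mathbb C$ with $\operatorname{Re}p_1\ge 0$ and $\operatorname{Im}p_1<\omega$ (in particular, $p_1$ may be any point of the fundamental strip $\operatorname{Re}p_1\ge0$, $0\le\operatorname{Im}p_1<\omega$), and let $a>1$. (i) Let $w=(w_n)_{n\in\mathbb Z}$ be a nonzero sequence in $H^2(\mathbb R^3)$ which solves $$(H_C-ip_1+n\omega)\,w_n=-\sum_{j\in\mathbb Z}\Omega_j\,w_{n-j}\qquad(n\in\mathbb Z)$$ and decays in $n$ in the sense that $\sum_{n}(1+|n|)^{4/3}\|w_n\|_{L^2(B_a)}^2<\infty$. Then $w_n=\chi_{B_1}w_n$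 almost everywhere on $\mathbb R^3$ for all $n<0$. (ii) The same holds on $B=B_a$ for solutions of the integral form of the system. Let $0<\varepsilon<\omega/2$, $p_c>b^2/4$ with $p_c/\omega\notin\mathbb Z$, $c>0$, and put $\beta(p)=c$ if $\operatorname{Im}p\in[-\varepsilon,p_c]$ and $\operatorname{Re}p\ge0$, and $\beta(p)=0$ otherwise. Let $\chi_B\mathfrak R_\beta(p)\chi_B$ be the truncated resolvent, $\mathfrak R_\beta(p)=(H_C-i\beta(p)\chi_B-ip)^{-1}$ for $\operatorname{Re}p>0$; for $\operatorname{Re}p=0$ it is understood as the limit in $L^2(B)$ of $\chi_B(H_C-i\beta(p)\chi_B-i(p+\delta))^{-1}\chi_B$ as $\delta\to0^+$. If $w=(w_n)_{n\in\mathbb Z}$ is a nonzero sequence in $L^2(B)$ with $\sum_{n}(1+|n|)^{4/3}\|w_n\|_{L^2(B)}^2<\infty$ and, for all $n\in\mathbb Z$, with $p=p_1+in\omega$, $$w_n=\chi_B\mathfrak R_\beta(p)\chi_B\Big[-i\beta(p)w_n-\sum_{j\in\mathbb Z}\Omega_j w_{n-j}\Big],$$ then $w_n=\chi_{B_1}w_n$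 almost everywhere on $B$ for all $n<0$. -/

import Mathlib

open MeasureTheory Filter Topology Metric Set
open scoped ENNReal SchwartzMap Laplacian

noncomputable section

/-- Physical space `ℝ³` with the Euclidean norm. -/
abbrev Space : Type := EuclideanSpace ℝ (Fin 3)

/-- The complex Hilbert space `L²(ℝ³)`. -/
abbrev LTwo : Type := Lp ℂ 2 (volume : Measure Space)

/-- `u ∈ H²(ℝ³)` and `H_C u = h` almost everywhere, where `H_C = -Δ - b / |x|` is the Coulomb
Hamiltonian with domain `H²(ℝ³)`. The Laplacian of `u` is taken in the sense of (tempered)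
distributions; `g` is its representative in `L²(ℝ³)`. -/
def HasCoulombImage (b : ℝ) (u : LTwo) (h : Space → ℂ) : Prop :=
  TemperedDistribution.MemSobolev 2 2 (u : 𝓢'(Space, ℂ)) ∧
    ∃ g : LTwo, Δ (u : 𝓢'(Space, ℂ)) = (g : 𝓢'(Space, ℂ)) ∧
      ∀ᵐ x : Space, h x = -g x - ((b / ‖x‖ : ℝ) : ℂ) * u x

/-- The potential `V(t, x) = ∑_{j ∈ ℤ} Ω_j(x) e^{i j ω t}`. -/
def potential (ω : ℝ) (Ω : ℤ → Space → ℂ) (t : ℝ) (x : Space) : ℂ :=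
  ∑' j : ℤ, Ω j x * Complex.exp (Complex.I * j * ω * t)

/-- Standing assumptions on the Fourier coefficients `Ω_j` of the time-periodic forcing: they are
supported in the closed unit ball, smooth inside it, `∑ (1 + |j|) ‖Ω_j‖_{L^∞(B_1)} < ∞`, the
forcing has zero time average, and `V` is real valued. -/
structure IsForcing (ω : ℝ) (Ω : ℤ → Space → ℂ) : Prop where
  support : ∀ (j : ℤ) (x : Space), 1 < ‖x‖ → Ω j x = 0
  smooth : ∀ j : ℤ, ContDiffOn ℝ (⊤ : ℕ∞) (Ω j) (ball 0 1)
  summable : ∑' j : ℤ, ENNReal.ofReal (1 + |(j : ℝ)|) *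
    eLpNorm (Ω j) ⊤ (volume.restrict (ball (0 : Space) 1)) ≠ ⊤
  zero_mean : ∀ x : Space, Ω 0 x = 0
  real_valued : ∀ (t : ℝ) (x : Space), (potential ω Ω t x).im = 0

/-- The coupling term `∑_{j ∈ ℤ} Ω_j(x) w_{n-j}(x)`. Under the standing assumptions and for the
sequences `w` considered below the series converges absolutely for almost every `x`. -/
def coupling (Ω : ℤ → Space → ℂ) (w : ℤ → Space → ℂ) (n : ℤ) (x : Space) : ℂ :=
  ∑' j : ℤ, Ω j x * w (n - j) x

/-- Decay in `n`: membership of the sequence `(w_n)` of functions on the ball `B_a` in the Hilbert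
space with norm `‖w‖² = ∑_{n ∈ ℤ} (1 + |n|)^{4/3} ‖w_n‖²_{L²(B_a)}`. -/
def MemSeqSpace (a : ℝ) (w : ℤ → Space → ℂ) : Prop :=
  (∀ n : ℤ, MemLp (w n) 2 (volume.restrict (ball (0 : Space) a))) ∧
    Summable fun n : ℤ =>
      (1 + |(n : ℝ)|) ^ (4 / 3 : ℝ) * ∫ x in ball (0 : Space) a, ‖w n x‖ ^ 2

/-- `w` is a sequence in `H²(ℝ³)` with
`(H_C - i p₁ + n ω) w_n = - ∑_{j ∈ ℤ} Ω_j w_{n-j}` for all `n ∈ ℤ`. -/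
def SolvesHomogeneous (b ω : ℝ) (Ω : ℤ → Space → ℂ) (p₁ : ℂ) (w : ℤ → LTwo) : Prop :=
  ∀ n : ℤ, ∃ h : Space → ℂ, HasCoulombImage b (w n) h ∧
    ∀ᵐ x : Space, h x + (-Complex.I * p₁ + n * ω) * w n x
      = -coupling Ω (fun m => (w m : Space → ℂ)) n x

/-- The cutoff function `β(p)`: it is `c` if `Im p ∈ [-ε, p_c]` and `Re p ≥ 0`, and `0`
otherwise. -/
def betaCut (ε pc c : ℝ) (p : ℂ) : ℝ :=
  if (-ε ≤ p.im ∧ p.im ≤ pc) ∧ 0 ≤ p.re then c else 0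

/-- `u = χ_B 𝔑_β(p) χ_B f` on `B = B_a`, where `𝔑_β(p) = (H_C - i β χ_B - i p)⁻¹` and
`Re p ≥ 0`. The truncated resolvent is its limit from the open right half plane: for `δ > 0` the
operator `H_C - i β χ_B - i (p + δ)` is boundedly invertible, `v δ ∈ H²(ℝ³)` is the image of
`χ_B f` under its inverse, and `v δ → u` in `L²(B)` as `δ → 0⁺`. Where `𝔑_β(p)` exists as a
bounded operator on `L²(ℝ³)` (in particular for `Re p > 0`) this is the ordinary resolvent; on the
continuous spectrum it is the boundary value of the resolvent. -/
def IsTruncatedResolvent (b a β : ℝ) (p : ℂ) (f u : Space → ℂ) : Prop :=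
  ∃ v : ℝ → LTwo,
    (∀ δ : ℝ, 0 < δ → ∃ h : Space → ℂ, HasCoulombImage b (v δ) h ∧
      ∀ᵐ x : Space, h x - Complex.I * β * (ball (0 : Space) a).indicator (v δ) x
        - Complex.I * (p + δ) * v δ x = (ball (0 : Space) a).indicator f x) ∧
    Tendsto (fun δ : ℝ =>
        eLpNorm (fun x => v δ x - u x) 2 (volume.restrict (ball (0 : Space) a)))
      (𝓝[>] 0) (𝓝 0)

/-- The integral form of the homogeneous system on `B = B_a`: for all `n ∈ ℤ`, with
`p = p₁ + i n ω`,
`w_n = χ_B 𝔑_β(p) χ_B [-i β(p) w_n - ∑_{j ∈ ℤ} Ω_j w_{n-j}]`. -/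
def SolvesIntegralForm (b ω : ℝ) (Ω : ℤ → Space → ℂ) (p₁ : ℂ) (a ε pc c : ℝ)
    (w : ℤ → Space → ℂ) : Prop :=
  ∀ n : ℤ, IsTruncatedResolvent b a (betaCut ε pc c (p₁ + Complex.I * n * ω))
    (p₁ + Complex.I * n * ω)
    (fun x => -Complex.I * betaCut ε pc c (p₁ + Complex.I * n * ω) * w n x - coupling Ω w n x)
    (w n)

end

/-! ### Global linear ODEs by a weighted contraction. -/

section LinearODE

open BoundedContinuousFunction

variable {F : Type*} [NormedAddCommGroup F] [NormedSpace ℝ F]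

/-! Pair the equation of channel `n` with `w n` and take imaginary parts. Since the Coulomb
Hamiltonian is symmetric (`HasCoulombImage.integral_conj_mul_im`), what remains is `Re p₁ * ‖w n‖ ^
2` on one side and the flux `Im ∫ conj (w n) * coupling` on the other. For the integral form the
same identity holds in the limit `δ → 0⁺`, with `(Re p₁ + δ) * ‖v δ‖ ^ 2` in place of the left side
(`tendsto_flux`). So every flux is nonnegative. A real potential has conjugate symmetric
coefficients, so the fluxes add up to zero (`hasSum_coupling_flux`), and hence each of them
vanishes.

If `Re p₁ > 0` this already gives `w n = 0`. If `Re p₁ = 0` and `n < 0`, then outside the unit ball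
the forcing is absent and the channel satisfies `(Δ + b / |x| + κ) w = 0` with `κ = -(Im p₁ + n ω) >
0`. A square integrable solution of this equation, or a limit of regularized solutions that radiate
no energy, must vanish there. This is a theorem of Rellich type: `ae_eq_zero_of_exterior_helmholtz`
and `ae_eq_zero_on_shell_of_no_flux`.

Rellich's theorem is proved by duality, without spherical harmonics or unique continuation. For each
`ξ` and `m`, the problem `(Δ + b / |x| + κ) φ = h(|x|) ⟪ξ, x⟫ ^ m` is solved outward from zero data
on the unit sphere (`exists_helmholtz_test`). The ansatz `∑ ⟪ξ, x⟫ ^ j |x| ^ (-(j + 1)) y_j(|x|)`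
turns it into a triangular radial system, whose solutions are bounded by an energy estimate
(`radialODE_bounded`). Hence `φ = O(1 / |x|)`, and a cutoff at scale `L` costs an error `O(1 / (L
|x|))` on the ball of radius `2 L`, of `L²` norm `O(L ^ (-1/2))`. Letting `L → ∞`, or taking `L = 1
/ δ` in the limiting version, annihilates every polynomial moment of the solution on a shell
(`exists_norm_integral_moment_le`). A boundedly supported function without moments is zero, because
its Fourier transform is (`ae_eq_zero_of_moments_eq_zero`). -/

/-- The weighted primitive `r ↦ ∫₁ʳ e^{-lam (r - s)} k(s) ds`, frozen to the left of `1`. -/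
noncomputable def weightedPrimitive (lam : ℝ) (k : ℝ → F) (r : ℝ) : F :=
  Real.exp (-(lam * max r 1)) • ∫ s in (1 : ℝ)..max r 1, Real.exp (lam * s) • k s

lemma weightedPrimitive_of_le (lam : ℝ) (k : ℝ → F) {r : ℝ} (hr : r ≤ 1) :
    weightedPrimitive lam k r = 0 := by
  simp [weightedPrimitive, max_eq_right hr]

/-- The factor `1 / lam` comes from integrating the exponential weight; it makes the Picard map a
contraction on the whole line at once. -/
lemma norm_weightedPrimitive_le {lam : ℝ} (hlam : 0 < lam) {k : ℝ → F}
    {C : ℝ} (hC : ∀ s, ‖k s‖ ≤ C) (r : ℝ) :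
    ‖weightedPrimitive lam k r‖ ≤ C / lam := by
  have hC0 : 0 ≤ C := (norm_nonneg _).trans (hC 0)
  have h1 : (1 : ℝ) ≤ max r 1 := le_max_right _ _
  have h2 : ‖∫ s in (1 : ℝ)..max r 1, Real.exp (lam * s) • k s‖
      ≤ ∫ s in (1 : ℝ)..max r 1, Real.exp (lam * s) * C := by
    apply intervalIntegral.norm_integral_le_of_norm_le h1
    · refine Eventually.of_forall fun s _ => ?_
      rw [norm_smul, Real.norm_eq_abs, abs_of_pos (Real.exp_pos _)]
      gcongr
      exact hC s
    · exact Continuous.intervalIntegrable (by fun_prop) _ _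
  have h3 : (∫ s in (1 : ℝ)..max r 1, Real.exp (lam * s) * C)
      = (Real.exp (lam * max r 1) - Real.exp (lam * 1)) / lam * C := by
    rw [intervalIntegral.integral_mul_const]
    congr 1
    have : ∀ x ∈ uIcc (1 : ℝ) (max r 1),
        HasDerivAt (fun s => Real.exp (lam * s) / lam) (Real.exp (lam * x)) x := by
      intro x _
      have := (((hasDerivAt_id x).const_mul lam).exp).div_const lam
      simpa [hlam.ne'] using this
    rw [intervalIntegral.integral_eq_sub_of_hasDerivAt this
      (Continuous.intervalIntegrable (by fun_prop) _ _)]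
    ring
  rw [weightedPrimitive, norm_smul, Real.norm_eq_abs, abs_of_pos (Real.exp_pos _)]
  calc Real.exp (-(lam * max r 1)) * ‖∫ s in (1 : ℝ)..max r 1, Real.exp (lam * s) • k s‖
      ≤ Real.exp (-(lam * max r 1)) * (Real.exp (lam * max r 1) / lam * C) := by
        gcongr
        rw [h3] at h2
        refine h2.trans ?_
        gcongr
        linarith [Real.exp_pos (lam * 1)]
    _ = C / lam := by
        rw [Real.exp_neg]
        field_simp

lemma continuous_weightedPrimitive (lam : ℝ) {k : ℝ → F} (hk : Continuous k) :
    Continuous (weightedPrimitive lam k) := by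
  unfold weightedPrimitive
  refine Continuous.smul (by fun_prop) ?_
  have : Continuous fun r : ℝ => ∫ s in (1 : ℝ)..r, Real.exp (lam * s) • k s :=
    intervalIntegral.continuous_primitive
      (fun a b => Continuous.intervalIntegrable (by fun_prop) _ _) 1
  exact this.comp (by fun_prop)

/-- Because `k` vanishes to the left of `1`, freezing at `max r 1` changes nothing, so there is no
corner at `r = 1`. -/
lemma hasDerivAt_weightedPrimitive [CompleteSpace F] (lam : ℝ) {k : ℝ → F} (hk : Continuous k)
    (hk1 : ∀ s ≤ 1, k s = 0) (r : ℝ) :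
    HasDerivAt (weightedPrimitive lam k) (-(lam • weightedPrimitive lam k r) + k r) r := by
  have heq : weightedPrimitive lam k
      = fun r => Real.exp (-(lam * r)) • ∫ s in (1 : ℝ)..r, Real.exp (lam * s) • k s := by
    funext r
    rcases le_total r 1 with hr | hr
    · rw [weightedPrimitive_of_le lam k hr, intervalIntegral.integral_congr (g := fun _ => 0)]
      · simp
      · intro s hs
        rw [uIcc_of_ge hr] at hs
        simp [hk1 s hs.2]
    · simp [weightedPrimitive, max_eq_left hr]
  have hc : Continuous fun s => Real.exp (lam * s) • k s := by fun_prop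
  have h1 := (hc.integral_hasStrictDerivAt 1 r).hasDerivAt
  have h2 : HasDerivAt (fun r : ℝ => Real.exp (-(lam * r)))
      (Real.exp (-(lam * r)) * (-lam)) r := by
    have := (((hasDerivAt_id r).const_mul lam).neg).exp
    simpa using this
  rw [heq]
  refine (h2.smul h1).congr_deriv ?_
  simp only
  rw [smul_smul, ← Real.exp_add, neg_add_cancel, Real.exp_zero, one_smul, smul_smul, add_comm,
    ← neg_smul]
  congr 2
  ring

/-- Global solvability of `Y' = M Y + H` with `Y = 0` to the left of `1`, for bounded continuous
coefficients. -/
lemma exists_linearODE_solution [CompleteSpace F] {M : ℝ → F →L[ℝ] F} (hM : Continuous M) {K : ℝ}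
    (hK : ∀ r, ‖M r‖ ≤ K) {H : ℝ → F} (hH : Continuous H) (hH1 : ∀ r ≤ 1, H r = 0)
    {D : ℝ} (hHD : ∀ r, ‖H r‖ ≤ D) :
    ∃ Y : ℝ → F, (∀ r ≤ 1, Y r = 0) ∧ ∀ r, HasDerivAt Y (M r (Y r) + H r) r := by
  have hK0 : 0 ≤ K := (norm_nonneg _).trans (hK 0)
  have hD0 : 0 ≤ D := (norm_nonneg _).trans (hHD 0)
  -- The unknown will be `Z = e^{-lam r} Y`. The term `2 * K` gives contraction constant `K / lam ≤
  -- 1 / 2`, and the `1` keeps `lam` positive when `K = 0`.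
  set lam : ℝ := 2 * K + 1 with hlam
  have hlam0 : 0 < lam := by positivity
  set G : ℝ → F := fun r => Real.exp (-(lam * r)) • H r with hG
  have hGc : Continuous G := by fun_prop
  have hG1 : ∀ r ≤ 1, G r = 0 := fun r hr => by simp [hG, hH1 r hr]
  have hGD : ∀ r, ‖G r‖ ≤ D := by
    intro r
    rcases le_total r 1 with hr | hr
    · rw [hG1 r hr, norm_zero]; exact hD0
    · rw [hG]
      simp only
      rw [norm_smul, Real.norm_eq_abs, abs_of_pos (Real.exp_pos _)]
      calc Real.exp (-(lam * r)) * ‖H r‖ ≤ 1 * D := by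
            gcongr
            · exact Real.exp_le_one_iff.2 (by nlinarith)
            · exact hHD r
        _ = D := one_mul D
  have hkc : ∀ Z : ℝ →ᵇ F, Continuous fun s => M s (Z s) + G s := fun Z =>
    (hM.clm_apply Z.continuous).add hGc
  have hkb : ∀ Z : ℝ →ᵇ F, ∀ s, ‖M s (Z s) + G s‖ ≤ K * ‖Z‖ + D := fun Z s =>
    (norm_add_le _ _).trans (add_le_add (((M s).le_opNorm _).trans
      (mul_le_mul (hK s) (Z.norm_coe_le_norm s) (norm_nonneg _) hK0)) (hGD s))
  let T : (ℝ →ᵇ F) → (ℝ →ᵇ F) := fun Z =>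
    BoundedContinuousFunction.ofNormedAddCommGroup (weightedPrimitive lam fun s => M s (Z s) + G s)
      (continuous_weightedPrimitive lam (hkc Z)) ((K * ‖Z‖ + D) / lam)
      (norm_weightedPrimitive_le hlam0 (hkb Z))
  have hT : ContractingWith (1 / 2) T := by
    refine ⟨by rw [← NNReal.coe_lt_coe]; norm_num, LipschitzWith.of_dist_le_mul fun Z W => ?_⟩
    rw [dist_eq_norm, BoundedContinuousFunction.norm_le (by positivity)]
    intro r
    have hsub : (T Z - T W) r = weightedPrimitive lam (fun s => M s (Z s - W s)) r := by
      change weightedPrimitive lam (fun s => M s (Z s) + G s) r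
        - weightedPrimitive lam (fun s => M s (W s) + G s) r = _
      unfold weightedPrimitive
      rw [← smul_sub, ← intervalIntegral.integral_sub]
      · congr 1
        refine intervalIntegral.integral_congr fun s _ => ?_
        simp only
        rw [← smul_sub, map_sub]
        congr 1
        abel
      · have := hkc Z
        exact Continuous.intervalIntegrable (by fun_prop) _ _
      · have := hkc W
        exact Continuous.intervalIntegrable (by fun_prop) _ _
    rw [hsub]
    refine (norm_weightedPrimitive_le hlam0 (C := K * dist Z W) ?_ r).trans ?_
    · intro s
      refine ((M s).le_opNorm _).trans (mul_le_mul (hK s) ?_ (norm_nonneg _) hK0)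
      rw [← dist_eq_norm]
      exact BoundedContinuousFunction.dist_coe_le_dist s
    · have : K / lam ≤ 1 / 2 := by
        rw [div_le_div_iff₀ hlam0 two_pos]; linarith
      calc K * dist Z W / lam = K / lam * dist Z W := by ring
        _ ≤ 1 / 2 * dist Z W := by gcongr
        _ = _ := by norm_num
  obtain ⟨Z, hZ⟩ : ∃ Z, T Z = Z := ⟨_, hT.fixedPoint_isFixedPt⟩
  have hZr : ∀ r, Z r = weightedPrimitive lam (fun s => M s (Z s) + G s) r := fun r =>
    (congrArg (fun f : ℝ →ᵇ F => f r) hZ).symm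
  have hZ1 : ∀ r ≤ 1, Z r = 0 := fun r hr => by rw [hZr, weightedPrimitive_of_le _ _ hr]
  have hZd : ∀ r, HasDerivAt Z (-(lam • Z r) + (M r (Z r) + G r)) r := by
    intro r
    have := hasDerivAt_weightedPrimitive lam (hkc Z)
      (fun s hs => by simp [hZ1 s hs, hG1 s hs]) r
    rw [← hZr r] at this
    refine this.congr_of_eventuallyEq (Eventually.of_forall hZr)
  refine ⟨fun r => Real.exp (lam * r) • Z r, fun r hr => by simp [hZ1 r hr], fun r => ?_⟩
  have h2 : HasDerivAt (fun r : ℝ => Real.exp (lam * r)) (Real.exp (lam * r) * lam) r := by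
    have := ((hasDerivAt_id r).const_mul lam).exp
    simpa using this
  refine (h2.smul (hZd r)).congr_deriv ?_
  simp only [hG]
  rw [map_smul, smul_add, smul_add, smul_smul _ _ (H r), ← Real.exp_add, add_neg_cancel,
    Real.exp_zero, one_smul, mul_smul, smul_neg]
  abel

/-- Bootstrapping: the equation expresses the derivative through `Y` itself, so each order of
smoothness yields the next. -/
lemma contDiffOn_of_linearODE {M : ℝ → F →L[ℝ] F} {H Y : ℝ → F} {U : Set ℝ} (hU : IsOpen U)
    (hM : ContDiffOn ℝ (⊤ : ℕ∞) M U) (hH : ContDiffOn ℝ (⊤ : ℕ∞) H U)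
    (hY : ∀ r ∈ U, HasDerivAt Y (M r (Y r) + H r) r) : ContDiffOn ℝ (⊤ : ℕ∞) Y U := by
  rw [contDiffOn_infty]
  intro n
  induction n with
  | zero =>
    exact contDiffOn_zero.2 fun r hr => (hY r hr).continuousAt.continuousWithinAt
  | succ n ih =>
    rw [Nat.cast_add, Nat.cast_one, contDiffOn_succ_iff_deriv_of_isOpen hU]
    refine ⟨fun r hr => (hY r hr).differentiableAt.differentiableWithinAt, by simp, ?_⟩
    have : ContDiffOn ℝ n (fun r => M r (Y r) + H r) U :=
      ((hM.of_le (mod_cast le_top)).clm_apply ih).add (hH.of_le (mod_cast le_top))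
    exact this.congr fun r hr => (hY r hr).deriv

end LinearODE

/-! ### Bounded solutions of the radial equation at positive energy. -/

section RadialODE

variable {E : Type*} [NormedAddCommGroup E] [InnerProductSpace ℝ E]

/-- Energy bound for `y'' = r⁻² A y - (b / r + κ) y + H`: since `b / r` decreases and `r⁻²` is
integrable at infinity, solutions starting from zero data remain bounded together with their
derivatives. -/
lemma radialODE_bounded {A : E →L[ℝ] E} {b κ : ℝ} (hb : 0 ≤ b) (hκ : 0 < κ) {H y v : ℝ → E}
    {D : ℝ} (hD : ∀ r, 1 ≤ r → ‖H r‖ ≤ D / r ^ 2) (hy : ∀ r, HasDerivAt y (v r) r)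
    (hv : ∀ r, 1 / 2 < r → HasDerivAt v ((r ^ 2)⁻¹ • A (y r) - (b / r + κ) • y r + H r) r)
    (hy1 : y 1 = 0) (hv1 : v 1 = 0) :
    ∃ C, ∀ r, 1 ≤ r → ‖y r‖ ≤ C ∧ ‖v r‖ ≤ C := by
  have hD0 : 0 ≤ D := by simpa using (norm_nonneg _).trans (hD 1 le_rfl)
  set K : ℝ := ‖A‖ / √κ + D with hK
  have hsκ : 0 < √κ := Real.sqrt_pos.2 hκ
  have hK0 : 0 ≤ K := by positivity
  -- In the derivative of this energy the cross terms in `(κ + b / r) y` cancel, and the decrease of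
  -- `b / r` has the favourable sign. The added `1` absorbs the forcing, which is only linear in
  -- `v`, through `2 ‖v‖ ≤ ‖v‖ ^ 2 + 1`.
  set S : ℝ → ℝ := fun r => ‖v r‖ ^ 2 + (κ + b / r) * ‖y r‖ ^ 2 + 1 with hS
  have hSd : ∀ r, 1 / 2 < r → HasDerivAt S
      (2 * inner ℝ (v r) ((r ^ 2)⁻¹ • A (y r) + H r) - b / r ^ 2 * ‖y r‖ ^ 2) r := by
    intro r hr
    have hr0 : r ≠ 0 := by linarith
    have h1 := (hv r hr).norm_sq
    have h2 := (hy r).norm_sq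
    have h3 : HasDerivAt (fun r : ℝ => κ + b / r) (-(b / r ^ 2)) r := by
      have := ((hasDerivAt_inv hr0).const_mul b).const_add κ
      simp only [div_eq_mul_inv]
      refine this.congr_deriv (by ring)
    refine ((h1.add (h3.mul h2)).add_const 1).congr_deriv ?_
    rw [sub_add_eq_add_sub, inner_sub_right, inner_smul_right, real_inner_comm (y r) (v r)]
    ring
  have hSb : ∀ r, 1 ≤ r →
      2 * inner ℝ (v r) ((r ^ 2)⁻¹ • A (y r) + H r) - b / r ^ 2 * ‖y r‖ ^ 2 ≤ K / r ^ 2 * S r := by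
    intro r hr
    have hr0 : 0 < r := by linarith
    have hbr : 0 ≤ b / r := by positivity
    have h1 : inner ℝ (v r) ((r ^ 2)⁻¹ • A (y r) + H r)
        ≤ ‖v r‖ * ((r ^ 2)⁻¹ * (‖A‖ * ‖y r‖) + D / r ^ 2) := by
      refine (real_inner_le_norm _ _).trans ?_
      gcongr
      refine (norm_add_le _ _).trans (add_le_add ?_ (hD r hr))
      rw [norm_smul, Real.norm_of_nonneg (by positivity)]
      gcongr
      exact A.le_opNorm _
    have h2 : 2 * ‖v r‖ * ‖y r‖ ≤ (√κ)⁻¹ * (‖v r‖ ^ 2 + κ * ‖y r‖ ^ 2) := by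
      rw [inv_mul_eq_div, le_div_iff₀ hsκ]
      have := Real.sq_sqrt hκ.le
      nlinarith [sq_nonneg (‖v r‖ - √κ * ‖y r‖)]
    have h3 : 2 * ‖v r‖ ≤ ‖v r‖ ^ 2 + 1 := by nlinarith [sq_nonneg (‖v r‖ - 1)]
    have h4 : 0 ≤ b / r ^ 2 * ‖y r‖ ^ 2 := by positivity
    have h5 : ‖v r‖ ^ 2 + κ * ‖y r‖ ^ 2 ≤ S r := by
      simp only [hS]; nlinarith [mul_nonneg hbr (sq_nonneg ‖y r‖)]
    have h6 : ‖v r‖ ^ 2 + 1 ≤ S r := by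
      simp only [hS]; nlinarith [mul_nonneg (add_nonneg hκ.le hbr) (sq_nonneg ‖y r‖)]
    calc _ ≤ 2 * (‖v r‖ * ((r ^ 2)⁻¹ * (‖A‖ * ‖y r‖) + D / r ^ 2)) := by linarith
      _ = (r ^ 2)⁻¹ * (‖A‖ * (2 * ‖v r‖ * ‖y r‖) + D * (2 * ‖v r‖)) := by ring
      _ ≤ (r ^ 2)⁻¹ * (‖A‖ * ((√κ)⁻¹ * S r) + D * S r) := by
        have h7 := h2.trans (mul_le_mul_of_nonneg_left h5 (inv_nonneg.2 hsκ.le))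
        have h8 := h3.trans h6
        refine mul_le_mul_of_nonneg_left (add_le_add ?_ ?_) (by positivity)
        · exact mul_le_mul_of_nonneg_left h7 (norm_nonneg _)
        · exact mul_le_mul_of_nonneg_left h8 hD0
      _ = K / r ^ 2 * S r := by rw [hK]; ring
  -- Grönwall with integrating factor `e^{K / r}`: the rate `K / r ^ 2` is integrable at infinity,
  -- so the bound does not grow with `r`.
  have hanti : AntitoneOn (fun r => S r * Real.exp (K / r)) (Ici 1) := by
    have hder : ∀ r, 1 / 2 < r → HasDerivAt (fun r => S r * Real.exp (K / r))
        ((2 * inner ℝ (v r) ((r ^ 2)⁻¹ • A (y r) + H r) - b / r ^ 2 * ‖y r‖ ^ 2)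
          * Real.exp (K / r) + S r * (Real.exp (K / r) * (-(K / r ^ 2)))) r := by
      intro r hr
      have hr0 : r ≠ 0 := by linarith
      have h3 : HasDerivAt (fun r : ℝ => K / r) (-(K / r ^ 2)) r := by
        have := (hasDerivAt_inv hr0).const_mul K
        simp only [div_eq_mul_inv]
        refine this.congr_deriv (by ring)
      exact (hSd r hr).mul h3.exp
    refine antitoneOn_of_deriv_nonpos (convex_Ici 1) ?_ ?_ ?_
    · intro r hr
      have hr : 1 ≤ r := hr
      exact (hder r (by linarith)).continuousAt.continuousWithinAt
    · intro r hr
      rw [interior_Ici] at hr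
      have hr : 1 < r := hr
      exact (hder r (by linarith)).differentiableAt.differentiableWithinAt
    · intro r hr
      rw [interior_Ici] at hr
      have hr : 1 < r := hr
      rw [(hder r (by linarith)).deriv]
      nlinarith [hSb r hr.le, Real.exp_pos (K / r)]
  have hSle : ∀ r, 1 ≤ r → S r ≤ Real.exp K := by
    intro r hr
    have h := hanti (mem_Ici.2 le_rfl) (mem_Ici.2 hr) hr
    simp only [hS, hy1, hv1] at h
    simp at h
    have h1 : 1 ≤ Real.exp (K / r) := Real.one_le_exp (by positivity)
    have h2 : 0 ≤ S r := by simp only [hS]; positivity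
    calc S r ≤ S r * Real.exp (K / r) := le_mul_of_one_le_right h2 h1
      _ ≤ _ := h
  refine ⟨√(Real.exp K / κ) + √(Real.exp K), fun r hr => ⟨?_, ?_⟩⟩
  · refine le_add_of_le_of_nonneg (Real.le_sqrt_of_sq_le ?_) (Real.sqrt_nonneg _)
    rw [le_div_iff₀ hκ]
    have h := hSle r hr
    simp only [hS] at h
    have : 0 ≤ b / r * ‖y r‖ ^ 2 := by positivity
    nlinarith [sq_nonneg ‖v r‖]
  · refine le_add_of_nonneg_of_le (Real.sqrt_nonneg _) (Real.le_sqrt_of_sq_le ?_)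
    have h := hSle r hr
    simp only [hS] at h
    have : 0 ≤ (κ + b / r) * ‖y r‖ ^ 2 := by positivity
    linarith

/-- Solutions of `y'' = r⁻² A y - (b / r + κ) y + H` which vanish for `r ≤ 1`, with compactly
supported forcing `H`, exist globally, are smooth, and are bounded together with their
derivatives. -/
lemma exists_radialODE_solution [CompleteSpace E] (A : E →L[ℝ] E) {b κ : ℝ} (hb : 0 ≤ b)
    (hκ : 0 < κ) {H : ℝ → E} (hH : ContDiff ℝ (⊤ : ℕ∞) H) (hH1 : ∀ r ≤ 1, H r = 0)
    {R : ℝ} (hR : ∀ r, R ≤ r → H r = 0) :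
    ∃ y v : ℝ → E, ContDiffOn ℝ (⊤ : ℕ∞) y (Ioi (1 / 2)) ∧ (∀ r, HasDerivAt y (v r) r) ∧
      (∀ r, 1 / 2 < r → HasDerivAt v ((r ^ 2)⁻¹ • A (y r) - (b / r + κ) • y r + H r) r) ∧
      (∀ r ≤ 1, y r = 0 ∧ v r = 0) ∧ ∃ C, ∀ r, 1 ≤ r → ‖y r‖ ≤ C ∧ ‖v r‖ ≤ C := by
  -- A bounded continuous replacement for `1 / r`. It agrees with `1 / r` beyond `1 / 2`, so the
  -- true equation holds on a neighbourhood of `r = 1`, and the solution vanishes for `r ≤ 1`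
  -- anyway.
  set ρ : ℝ → ℝ := fun r => (max r (1 / 2))⁻¹ with hρ
  have hρpos : ∀ r, 0 < max r (1 / 2 : ℝ) := fun r => lt_max_of_lt_right (by norm_num)
  have hρc : Continuous ρ := by
    refine Continuous.inv₀ (by fun_prop) fun r => (hρpos r).ne'
  have hρ0 : ∀ r, 0 ≤ ρ r := fun r => (inv_pos.2 (hρpos r)).le
  have hρ2 : ∀ r, ρ r ≤ 2 := fun r => by
    rw [hρ]
    simp only
    rw [inv_le_comm₀ (hρpos r) two_pos]
    exact le_max_of_le_right (by norm_num)
  have hρr : ∀ r, 1 / 2 < r → ρ r = r⁻¹ := fun r hr => by simp only [hρ]; rw [max_eq_left hr.le]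
  set P : E × E →L[ℝ] E := ContinuousLinearMap.fst ℝ E E
  set i1 : E →L[ℝ] E × E := ContinuousLinearMap.inl ℝ E E
  set i2 : E →L[ℝ] E × E := ContinuousLinearMap.inr ℝ E E
  set S : E × E →L[ℝ] E × E := i1 ∘L ContinuousLinearMap.snd ℝ E E
  set A' : E × E →L[ℝ] E × E := i2 ∘L A ∘L P
  set J : E × E →L[ℝ] E × E := i2 ∘L P
  set M : ℝ → (E × E →L[ℝ] E × E) := fun r => S + (ρ r ^ 2) • A' - (b * ρ r + κ) • J with hM
  have hMc : Continuous M := by fun_prop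
  obtain ⟨D, hD⟩ : ∃ D, ∀ r, ‖H r‖ ≤ D := by
    have hcs : HasCompactSupport H := by
      refine HasCompactSupport.intro (isCompact_Icc (a := (1 : ℝ)) (b := R)) fun r hr => ?_
      rw [mem_Icc, not_and_or] at hr
      rcases hr with hr | hr
      · exact hH1 r (by linarith)
      · exact hR r (by linarith)
    exact hcs.exists_bound_of_continuous hH.continuous
  have hD0 : 0 ≤ D := (norm_nonneg _).trans (hD 0)
  obtain ⟨Y, hY1, hYd⟩ := exists_linearODE_solution (M := M) hMc
    (K := ‖S‖ + 4 * ‖A'‖ + (b * 2 + κ) * ‖J‖) (H := fun r => i2 (H r)) (D := ‖i2‖ * D)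
    (by
      intro r
      refine (norm_sub_le _ _).trans (add_le_add ((norm_add_le _ _).trans
        (add_le_add le_rfl ?_)) ?_)
      · rw [norm_smul, Real.norm_of_nonneg (by positivity)]
        gcongr
        nlinarith [hρ0 r, hρ2 r]
      · have := hρ0 r
        rw [norm_smul, Real.norm_of_nonneg (by positivity)]
        gcongr
        exact hρ2 r)
    (i2.continuous.comp hH.continuous) (fun r hr => by rw [hH1 r hr, map_zero])
    (fun r => (i2.le_opNorm _).trans (by gcongr; exact hD r))
  have hy : ∀ r, HasDerivAt (fun r => (Y r).1) ((Y r).2) r := by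
    intro r
    have := P.hasFDerivAt.comp_hasDerivAt r (hYd r)
    refine this.congr_deriv ?_
    simp [hM, S, A', J, i1, i2, P]
  have hv : ∀ r, 1 / 2 < r → HasDerivAt (fun r => (Y r).2)
      ((r ^ 2)⁻¹ • A (Y r).1 - (b / r + κ) • (Y r).1 + H r) r := by
    intro r hr
    have := (ContinuousLinearMap.snd ℝ E E).hasFDerivAt.comp_hasDerivAt r (hYd r)
    refine this.congr_deriv ?_
    simp [hM, S, A', J, i1, i2, P, hρr r hr, div_eq_mul_inv]
  refine ⟨fun r => (Y r).1, fun r => (Y r).2, ?_, hy, hv, fun r hr => by simp [hY1 r hr], ?_⟩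
  · have hinv : ContDiffOn ℝ (⊤ : ℕ∞) ρ (Ioi (1 / 2)) := by
      have : ContDiffOn ℝ (⊤ : ℕ∞) (fun r : ℝ => r⁻¹) (Ioi (1 / 2)) :=
        contDiffOn_id.inv fun r hr => by
          have hr : (1 : ℝ) / 2 < r := hr
          simp only [id]; linarith
      exact this.congr fun r hr => hρr r hr
    have : ContDiffOn ℝ (⊤ : ℕ∞) Y (Ioi (1 / 2)) :=
      contDiffOn_of_linearODE isOpen_Ioi (M := M) (by fun_prop)
        ((i2.contDiff.comp hH).contDiffOn) fun r _ => hYd r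
    exact this.fst
  · refine radialODE_bounded (A := A) (H := H) (D := D * max R 1 ^ 2) hb hκ ?_ hy hv
      (by simp [hY1 1 le_rfl]) (by simp [hY1 1 le_rfl])
    intro r hr
    rw [le_div_iff₀ (by positivity)]
    rcases le_total R r with h | h
    · rw [hR r h, norm_zero, zero_mul]; positivity
    · gcongr
      · exact hD r
      · exact h.trans (le_max_left _ _)

end RadialODE

/-! ### Laplacian of a power of a linear form times a radial function. -/

section RadialLaplacian

variable {E : Type*} [NormedAddCommGroup E] [InnerProductSpace ℝ E]

lemma hasFDerivAt_norm_of_ne_zero {x : E} (hx : x ≠ 0) :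
    HasFDerivAt (fun y : E => ‖y‖) (‖x‖⁻¹ • innerSL ℝ x) x := by
  have h := (hasStrictFDerivAt_norm_sq x).hasFDerivAt.sqrt (by positivity)
  have h0 : ‖x‖ ≠ 0 := norm_ne_zero_iff.2 hx
  refine (h.congr_of_eventuallyEq (Eventually.of_forall fun y => ?_)).congr_fderiv ?_
  · simp
  · ext z
    simp [Real.sqrt_sq (norm_nonneg x)]
    field_simp

lemma hasFDerivAt_radial {G : ℝ → ℝ} {g : ℝ} {x : E} (hx : x ≠ 0) (hG : HasDerivAt G g ‖x‖) :
    HasFDerivAt (fun y : E => G ‖y‖) ((g * ‖x‖⁻¹) • innerSL ℝ x) x := by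
  refine (hG.comp_hasFDerivAt x (hasFDerivAt_norm_of_ne_zero hx)).congr_fderiv ?_
  rw [smul_smul]

lemma hasFDerivAt_inner_pow (ξ : E) (j : ℕ) (x : E) :
    HasFDerivAt (fun y : E => (inner ℝ ξ y) ^ j) ((j * inner ℝ ξ x ^ (j - 1)) • innerSL ℝ ξ) x := by
  have := ((innerSL ℝ ξ).hasFDerivAt (x := x)).pow j
  simpa using this

/-- Laplacian of a power of a linear form times a radial function. -/
lemma laplacian_inner_pow_mul_radial [FiniteDimensional ℝ E] (ξ : E) (j : ℕ) {G G₁ : ℝ → ℝ}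
    {g : ℝ} {x : E} (hx : x ≠ 0) (hG : ∀ᶠ r in 𝓝 ‖x‖, HasDerivAt G (G₁ r) r)
    (hG₁ : HasDerivAt G₁ g ‖x‖) :
    (Δ (fun y : E => inner ℝ ξ y ^ j * G ‖y‖)) x
      = j * (j - 1) * ‖ξ‖ ^ 2 * inner ℝ ξ x ^ (j - 2) * G ‖x‖
        + inner ℝ ξ x ^ j * (g + (2 * j + Module.finrank ℝ E - 1) / ‖x‖ * G₁ ‖x‖) := by
  have hr : ‖x‖ ≠ 0 := norm_ne_zero_iff.2 hx
  set p : E → ℝ := fun y => j * inner ℝ ξ y ^ (j - 1) * G ‖y‖ with hp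
  set q : E → ℝ := fun y => inner ℝ ξ y ^ j * (G₁ ‖y‖ * ‖y‖⁻¹) with hq
  have hcont : ContinuousAt (fun y : E => ‖y‖) x := continuous_norm.continuousAt
  have hfd : fderiv ℝ (fun y : E => inner ℝ ξ y ^ j * G ‖y‖)
      =ᶠ[𝓝 x] fun y => p y • innerSL ℝ ξ + q y • innerSL ℝ y := by
    filter_upwards [hcont.eventually hG, eventually_ne_nhds hx] with y hy hy0
    rw [HasFDerivAt.fderiv (f := fun y : E => inner ℝ ξ y ^ j * G ‖y‖)
      ((hasFDerivAt_inner_pow ξ j y).mul (hasFDerivAt_radial hy0 hy))]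
    ext z
    simp [hp, hq]
    ring
  have hGx : HasDerivAt G (G₁ ‖x‖) ‖x‖ := hG.self_of_nhds
  have hpd : HasFDerivAt p ((j * inner ℝ ξ x ^ (j - 1)) • ((G₁ ‖x‖ * ‖x‖⁻¹) • innerSL ℝ x)
      + G ‖x‖ • ((j * ((j - 1 : ℕ) * inner ℝ ξ x ^ (j - 1 - 1))) • innerSL ℝ ξ)) x := by
    refine (((hasFDerivAt_inner_pow ξ (j - 1) x).const_mul (j : ℝ)).mul
      (hasFDerivAt_radial hx hGx)).congr_fderiv ?_
    simp only [smul_smul]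
  have hqd : HasFDerivAt q (inner ℝ ξ x ^ j • (((g * ‖x‖⁻¹ + G₁ ‖x‖ * (-(‖x‖ ^ 2)⁻¹)) * ‖x‖⁻¹)
      • innerSL ℝ x) + (G₁ ‖x‖ * ‖x‖⁻¹) • ((j * inner ℝ ξ x ^ (j - 1)) • innerSL ℝ ξ)) x :=
    (hasFDerivAt_inner_pow ξ j x).mul
      (hasFDerivAt_radial (G := fun r => G₁ r * r⁻¹) hx (hG₁.mul (hasDerivAt_inv hr)))
  have hsecond : fderiv ℝ (fderiv ℝ (fun y : E => inner ℝ ξ y ^ j * G ‖y‖)) x = _ :=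
    hfd.fderiv_eq.trans ((hpd.smul_const (innerSL ℝ ξ)).add
      (hqd.smul ((innerSL ℝ (E := E)).hasFDerivAt))).fderiv
  rw [InnerProductSpace.laplacian_eq_iteratedFDeriv_stdOrthonormalBasis]
  simp only [iteratedFDeriv_two_apply, hsecond]
  set e := stdOrthonormalBasis ℝ E
  have hsum : ∀ u v : E, ∑ i, inner ℝ u (e i) * inner ℝ v (e i) = inner ℝ u v := by
    intro u v
    rw [← e.sum_inner_mul_inner u v]
    simp [real_inner_comm]
  have hone : ∀ i, inner ℝ (e i) (e i) = (1 : ℝ) := fun i => by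
    rw [real_inner_self_eq_norm_sq, e.norm_eq_one]; norm_num
  have hinn : ∀ u v : E, (innerSL ℝ u) v = inner ℝ u v := fun u v => rfl
  simp only [Matrix.cons_val_zero, Matrix.cons_val_one, Matrix.cons_val_fin_one,
    add_apply, smul_apply, smul_eq_mul,
    ContinuousLinearMap.smulRight_apply, hinn, hone]
  simp only [add_mul, Finset.sum_add_distrib, mul_assoc, ← Finset.mul_sum, hsum, mul_add, mul_one,
    Finset.sum_const, Finset.card_univ, Fintype.card_fin]
  simp only [hq, real_inner_self_eq_norm_sq, real_inner_comm ξ x, nsmul_eq_mul]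
  -- The exponents `j - 1` and `j - 2` are truncated subtractions; for `j = 0, 1` the coefficient `j
  -- * (j - 1)` makes this harmless.
  rcases j with _ | _ | j
  · simp
    field_simp
    ring
  · simp
    field_simp
    ring
  · simp only [Nat.add_sub_cancel, pow_succ, Nat.reduceSubDiff]
    push_cast
    field_simp
    ring

end RadialLaplacian

/-! ### The triangular radial system for the ansatz, and radial cutoffs. -/

section RadialSystem

/-- The coordinate `y_j`, extended by zero beyond the last index. -/
noncomputable def coordOrZero (m j : ℕ) : EuclideanSpace ℝ (Fin (m + 1)) →ₗ[ℝ] ℝ :=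
  if hj : j < m + 1 then (EuclideanSpace.proj (𝕜 := ℝ) (⟨j, hj⟩ : Fin (m + 1))).toLinearMap else 0

lemma coordOrZero_of_lt {m j : ℕ} (hj : j < m + 1) (y : EuclideanSpace ℝ (Fin (m + 1))) :
    coordOrZero m j y = y ⟨j, hj⟩ := by
  simp [coordOrZero, hj]

lemma coordOrZero_of_ge {m j : ℕ} (hj : m < j) : coordOrZero m j = 0 := by
  have : ¬ j < m + 1 := by omega
  simp [coordOrZero, this]

lemma abs_coordOrZero_le (m j : ℕ) (y : EuclideanSpace ℝ (Fin (m + 1))) :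
    |coordOrZero m j y| ≤ ‖y‖ := by
  by_cases hj : j < m + 1
  · rw [coordOrZero_of_lt hj]
    exact PiLp.norm_apply_le y _
  · rw [coordOrZero_of_ge (by omega)]
    simp

/-- The coupling matrix of the radial system satisfied by the moments of powers of a linear form,
`s` being the squared norm of the form. -/
noncomputable def momentCoupling (m : ℕ) (s : ℝ) :
    EuclideanSpace ℝ (Fin (m + 1)) →L[ℝ] EuclideanSpace ℝ (Fin (m + 1)) :=
  LinearMap.toContinuousLinearMap
    { toFun := fun y => WithLp.toLp 2 fun j : Fin (m + 1) =>
        (j : ℝ) * (j + 1) * y j - ((j : ℝ) + 2) * (j + 1) * s * coordOrZero m (j + 2) y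
      map_add' := fun y z => by ext j; simp; ring
      map_smul' := fun c y => by ext j; simp; ring }

lemma momentCoupling_apply (m : ℕ) (s : ℝ) (y : EuclideanSpace ℝ (Fin (m + 1)))
    (j : Fin (m + 1)) : momentCoupling m s y j
      = (j : ℝ) * (j + 1) * y j - ((j : ℝ) + 2) * (j + 1) * s * coordOrZero m (j + 2) y := rfl

/-- Bounded smooth solutions of the triangular radial system which makes
`∑ⱼ ⟪ξ, x⟫ʲ |x|^{-(j + 1)} yⱼ(|x|)` solve a Helmholtz equation with Coulomb potential. -/
lemma exists_radialSystem_solution (m : ℕ) (s : ℝ) {b κ : ℝ} (hb : 0 ≤ b) (hκ : 0 < κ)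
    {h : ℝ → ℝ} (hh : ContDiff ℝ (⊤ : ℕ∞) h) (hh1 : ∀ r ≤ 1, h r = 0) {R : ℝ}
    (hR : ∀ r, R ≤ r → h r = 0) :
    ∃ y v : ℕ → ℝ → ℝ, (∀ j r, m < j → y j r = 0) ∧
      (∀ j, ContDiffOn ℝ (⊤ : ℕ∞) (y j) (Ioi (1 / 2))) ∧
      (∀ j r, HasDerivAt (y j) (v j r) r) ∧
      (∀ j r, j ≤ m → 1 / 2 < r → HasDerivAt (v j)
        ((r ^ 2)⁻¹ * ((j : ℝ) * (j + 1) * y j r - ((j : ℝ) + 2) * (j + 1) * s * y (j + 2) r)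
          - (b / r + κ) * y j r + if j = m then r ^ (m + 1) * h r else 0) r) ∧
      (∀ j, ∀ r ≤ 1, y j r = 0 ∧ v j r = 0) ∧
      ∃ C, ∀ j r, 1 ≤ r → |y j r| ≤ C ∧ |v j r| ≤ C := by
  obtain ⟨y, v, hys, hy, hv, hy1, C, hC⟩ := exists_radialODE_solution (momentCoupling m s) hb hκ
    (H := fun r => (r ^ (m + 1) * h r) • EuclideanSpace.single (Fin.last m) (1 : ℝ))
    (by fun_prop) (fun r hr => by simp [hh1 r hr]) (R := R) (fun r hr => by simp [hR r hr])
  set c : ℕ → (EuclideanSpace ℝ (Fin (m + 1)) →L[ℝ] ℝ) := fun j =>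
    LinearMap.toContinuousLinearMap (coordOrZero m j) with hc
  have hcapp : ∀ j z, c j z = coordOrZero m j z := fun j z => rfl
  refine ⟨fun j r => c j (y r), fun j r => c j (v r), ?_, ?_, ?_, ?_, ?_, C, ?_⟩
  · intro j r hj
    simp [hcapp, coordOrZero_of_ge hj]
  · exact fun j => (c j).contDiff.comp_contDiffOn hys
  · exact fun j r => (c j).hasFDerivAt.comp_hasDerivAt r (hy r)
  · intro j r hj hr
    refine ((c j).hasFDerivAt.comp_hasDerivAt r (hv r hr)).congr_deriv ?_
    have hj' : j < m + 1 := by omega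
    simp only [hcapp, map_add, map_sub, map_smul, smul_eq_mul]
    simp only [coordOrZero_of_lt hj', momentCoupling_apply]
    by_cases hjm : j = m
    · subst hjm
      have : (⟨j, hj'⟩ : Fin (j + 1)) = Fin.last j := rfl
      simp [this]
    · have : (⟨j, hj'⟩ : Fin (m + 1)) ≠ Fin.last m := fun h => hjm (congrArg Fin.val h)
      simp [this, hjm]
  · exact fun j r hr => by simp [hy1 r hr]
  · exact fun j r hr => ⟨(abs_coordOrZero_le m j _).trans (hC r hr).1,
      (abs_coordOrZero_le m j _).trans (hC r hr).2⟩

/-- Smooth cutoffs at scale `L` with derivatives of size `1 / L`. -/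
lemma exists_cutoff : ∃ c : ℝ, ∀ L : ℝ, 1 ≤ L → ∃ χ χ₁ χ₂ : ℝ → ℝ,
    ContDiff ℝ (⊤ : ℕ∞) χ ∧ (∀ r, HasDerivAt χ (χ₁ r) r) ∧ (∀ r, HasDerivAt χ₁ (χ₂ r) r) ∧
    (∀ r ≤ L, χ r = 1) ∧ (∀ r, 2 * L ≤ r → χ r = 0) ∧ (∀ r, |χ r| ≤ 1) ∧
    (∀ r, |χ₁ r| ≤ c / L) ∧ (∀ r, |χ₂ r| ≤ c / L) ∧
    ∀ r, 2 * L < r → χ₁ r = 0 ∧ χ₂ r = 0 := by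
  set f : ℝ → ℝ := fun t => Real.smoothTransition (2 - t) with hf
  have hfs : ContDiff ℝ (⊤ : ℕ∞) f := Real.smoothTransition.contDiff.comp (by fun_prop)
  have hf1 : ContDiff ℝ (⊤ : ℕ∞) (deriv f) := (contDiff_infty_iff_deriv.1 hfs).2
  have hf2 : ContDiff ℝ (⊤ : ℕ∞) (deriv (deriv f)) := (contDiff_infty_iff_deriv.1 hf1).2
  have hlow : ∀ t, t ≤ 1 → f t = 1 := fun t ht =>
    Real.smoothTransition.one_of_one_le (by linarith)
  have hhigh : ∀ t, 2 ≤ t → f t = 0 := fun t ht => Real.smoothTransition.zero_of_nonpos (by linarith)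
  have hz1 : ∀ t, t < 1 ∨ 2 < t → deriv f t = 0 := by
    rintro t (ht | ht)
    · have : f =ᶠ[𝓝 t] fun _ => 1 := by
        filter_upwards [Iio_mem_nhds ht] with s hs using hlow s (le_of_lt hs)
      simpa using this.deriv_eq
    · have : f =ᶠ[𝓝 t] fun _ => 0 := by
        filter_upwards [Ioi_mem_nhds ht] with s hs using hhigh s (le_of_lt hs)
      simpa using this.deriv_eq
  have hz2 : ∀ t, t < 1 ∨ 2 < t → deriv (deriv f) t = 0 := by
    rintro t (ht | ht)
    · have : deriv f =ᶠ[𝓝 t] fun _ => 0 := by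
        filter_upwards [Iio_mem_nhds ht] with s hs using hz1 s (Or.inl hs)
      simpa using this.deriv_eq
    · have : deriv f =ᶠ[𝓝 t] fun _ => 0 := by
        filter_upwards [Ioi_mem_nhds ht] with s hs using hz1 s (Or.inr hs)
      simpa using this.deriv_eq
  have hcs : ∀ g : ℝ → ℝ, (∀ t, t < 1 ∨ 2 < t → g t = 0) → HasCompactSupport g := fun g hg =>
    HasCompactSupport.intro (isCompact_Icc (a := (1 : ℝ)) (b := 2)) fun t ht => by
      rw [mem_Icc, not_and_or, not_le, not_le] at ht
      exact hg t ht
  obtain ⟨c₁, hc₁⟩ := (hcs _ hz1).exists_bound_of_continuous hf1.continuous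
  obtain ⟨c₂, hc₂⟩ := (hcs _ hz2).exists_bound_of_continuous hf2.continuous
  have hc10 := (norm_nonneg _).trans (hc₁ 0)
  have hc20 := (norm_nonneg _).trans (hc₂ 0)
  refine ⟨c₁ + c₂, fun L hL => ⟨fun r => f (r / L), fun r => deriv f (r / L) / L,
    fun r => deriv (deriv f) (r / L) / L / L, hfs.comp (by fun_prop), ?_, ?_, ?_, ?_, ?_, ?_, ?_,
    ?_⟩⟩
  · intro r
    have := ((hfs.differentiable (by simp)) (r / L)).hasDerivAt.comp r ((hasDerivAt_id r).div_const L)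
    exact this.congr_deriv (by ring)
  · intro r
    have := (((hf1.differentiable (by simp)) (r / L)).hasDerivAt.comp r
      ((hasDerivAt_id r).div_const L)).div_const L
    exact this.congr_deriv (by ring)
  · exact fun r hr => hlow _ (by rw [div_le_one (by linarith)]; exact hr)
  · exact fun r hr => hhigh _ (by rw [le_div_iff₀ (by linarith)]; exact hr)
  · exact fun r => abs_le.2 ⟨by linarith [Real.smoothTransition.nonneg (2 - r / L)],
      Real.smoothTransition.le_one _⟩
  · intro r
    rw [abs_div, abs_of_pos (by linarith : 0 < L)]
    gcongr
    exact (hc₁ _).trans (by linarith)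
  · intro r
    rw [abs_div, abs_div, abs_of_pos (by linarith : 0 < L)]
    gcongr
    -- The second derivative is in fact `O(1 / L ^ 2)`; since `1 ≤ L`, the weaker bound `c / L`
    -- follows and is enough.
    exact (div_le_self (abs_nonneg _) hL).trans ((hc₂ _).trans (by linarith))
  · intro r hr
    have : 2 < r / L := by rw [lt_div_iff₀ (by linarith)]; exact hr
    simp [hz1 _ (Or.inr this), hz2 _ (Or.inr this)]

end RadialSystem

/-! ### Test functions for the exterior Helmholtz–Coulomb problem. -/

section TestFunctions

/-- The Laplacian of `⟪ξ, x⟫ʲ |x|^{-(j + 1)} z(|x|)` on `ℝ³`. -/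
lemma laplacian_moment (ξ : Space) (j : ℕ) {z z₁ : ℝ → ℝ} {z₂ : ℝ} {x : Space} (hx : x ≠ 0)
    (hz : ∀ r, HasDerivAt z (z₁ r) r) (hz₁ : HasDerivAt z₁ z₂ ‖x‖) :
    (Δ (fun y : Space => inner ℝ ξ y ^ j * (z ‖y‖ * (‖y‖ ^ (j + 1))⁻¹))) x
      = j * (j - 1) * ‖ξ‖ ^ 2 * inner ℝ ξ x ^ (j - 2) * (z ‖x‖ * (‖x‖ ^ (j + 1))⁻¹)
        + inner ℝ ξ x ^ j * ((‖x‖ ^ (j + 1))⁻¹ *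
          (z₂ - (‖x‖ ^ 2)⁻¹ * (j * (j + 1) * z ‖x‖))) := by
  have hr : 0 < ‖x‖ := norm_pos_iff.2 hx
  have hinv : ∀ k : ℕ, ∀ r : ℝ, r ≠ 0 →
      HasDerivAt (fun r : ℝ => (r ^ (k + 1))⁻¹) (-((k + 1 : ℕ) * (r ^ (k + 2))⁻¹)) r := by
    intro k r hr
    have := (hasDerivAt_pow (k + 1) r).inv (pow_ne_zero _ hr)
    refine this.congr_deriv ?_
    simp only [Nat.add_sub_cancel]
    field_simp
    ring
  rw [laplacian_inner_pow_mul_radial ξ j hx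
    (G := fun r => z r * (r ^ (j + 1))⁻¹)
    (G₁ := fun r => z₁ r * (r ^ (j + 1))⁻¹ + z r * (-((j + 1 : ℕ) * (r ^ (j + 2))⁻¹)))
    (by
      filter_upwards [lt_mem_nhds hr] with r hr
      exact (hz r).mul (hinv j r hr.ne'))
    ((hz₁.mul (hinv j _ hr.ne')).add ((hz ‖x‖).mul (((hinv (j + 1) _ hr.ne').const_mul _).neg)))]
  congr 2
  simp only [finrank_euclideanSpace, Fintype.card_fin]
  push_cast
  field_simp
  ring

/-- `|x|⁻¹` cut off at radius `ρ`. -/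
noncomputable def truncatedInv (ρ : ℝ) (x : Space) : ℝ := if ‖x‖ ≤ ρ then ‖x‖⁻¹ else 0

lemma truncatedInv_nonneg (ρ : ℝ) (x : Space) : 0 ≤ truncatedInv ρ x := by
  unfold truncatedInv; split_ifs <;> positivity

/-- Test functions for the exterior Helmholtz–Coulomb problem at positive energy `κ`: compactly
supported solutions, up to a small error spread over the scale `L`, of
`(Δ + b / |x| + κ) φ = h(|x|) ⟪ξ, x⟫ᵐ` which vanish on the unit ball. -/
lemma exists_helmholtz_test (ξ : Space) (m : ℕ) {b κ : ℝ} (hb : 0 ≤ b) (hκ : 0 < κ)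
    {h : ℝ → ℝ} (hh : ContDiff ℝ (⊤ : ℕ∞) h) (hh1 : ∀ r ≤ 1, h r = 0) {R : ℝ}
    (hR : ∀ r, R ≤ r → h r = 0) :
    ∃ C : ℝ, 0 ≤ C ∧ ∀ L, 1 ≤ L → R ≤ L → ∃ φ e : Space → ℝ, ContDiff ℝ (⊤ : ℕ∞) φ ∧
      HasCompactSupport φ ∧ (∀ x, ‖x‖ ≤ 1 → φ x = 0) ∧
      (∀ x, (Δ φ) x + (b / ‖x‖ + κ) * φ x = h ‖x‖ * inner ℝ ξ x ^ m + e x) ∧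
      (∀ x, |φ x| ≤ C * truncatedInv (2 * L) x) ∧
      ∀ x, |e x| ≤ C / L * truncatedInv (2 * L) x := by
  obtain ⟨y, v, hym, hys, hy, hv, hy1, C, hC⟩ :=
    exists_radialSystem_solution m (‖ξ‖ ^ 2) hb hκ hh hh1 hR
  obtain ⟨c, hc⟩ := exists_cutoff
  have hC0 : 0 ≤ C := (abs_nonneg _).trans (hC 0 1 le_rfl).1
  have hc0 : 0 ≤ c := by
    obtain ⟨χ, χ₁, χ₂, -, -, -, -, -, -, h1, -⟩ := hc 1 le_rfl
    simpa using (abs_nonneg _).trans (h1 0)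
  set Sξ : ℝ := ∑ j ∈ Finset.range (m + 1), ‖ξ‖ ^ j with hSξ
  have hS0 : 0 ≤ Sξ := Finset.sum_nonneg fun j _ => by positivity
  refine ⟨Sξ * (C + 3 * c * C), by positivity, fun L hL hRL => ?_⟩
  obtain ⟨χ, χ₁, χ₂, hχs, hχd, hχd1, hχone, hχzero, hχle, hχ1, hχ2, hχhigh⟩ := hc L hL
  have hL0 : 0 < L := by linarith
  set z : ℕ → ℝ → ℝ := fun j r => χ r * y j r with hz
  set z₁ : ℕ → ℝ → ℝ := fun j r => χ₁ r * y j r + χ r * v j r with hz1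
  -- The commutator of the second radial derivative with the cutoff. It carries the whole error `e`,
  -- and its two terms account for the constant `3 * c * C`.
  set ε : ℕ → ℝ → ℝ := fun j r => χ₂ r * y j r + 2 * (χ₁ r * v j r) with hε
  have hzd : ∀ j r, HasDerivAt (z j) (z₁ j r) r := fun j r => (hχd r).mul (hy j r)
  set f : ℕ → Space → ℝ := fun j x => inner ℝ ξ x ^ j * (z j ‖x‖ * (‖x‖ ^ (j + 1))⁻¹) with hf
  set φ : Space → ℝ := fun x => ∑ j ∈ Finset.range (m + 1), f j x with hφ
  set e : Space → ℝ := fun x => ∑ j ∈ Finset.range (m + 1),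
    inner ℝ ξ x ^ j * (ε j ‖x‖ * (‖x‖ ^ (j + 1))⁻¹) with he
  have hf1 : ∀ j x, ‖x‖ ≤ 1 → f j x = 0 := fun j x hx => by simp [hf, hz, hy1 j _ hx]
  have hφ1 : ∀ x, ‖x‖ ≤ 1 → φ x = 0 := fun x hx => Finset.sum_eq_zero fun j _ => hf1 j x hx
  have hfs : ∀ j, ContDiff ℝ (⊤ : ℕ∞) (f j) := by
    intro j
    rw [contDiff_iff_contDiffAt]
    intro x
    -- Smoothness of `‖x‖`, of its negative powers and of `y j` is available only away from the
    -- origin; near it `f j` is identically zero.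
    rcases lt_or_ge (1 / 2) ‖x‖ with hx | hx
    · have hx0 : x ≠ 0 := norm_pos_iff.1 (by linarith)
      have hn : ContDiffAt ℝ (⊤ : ℕ∞) (fun x : Space => ‖x‖) x := contDiffAt_norm ℝ hx0
      have hyx : ContDiffAt ℝ (⊤ : ℕ∞) (fun x : Space => y j ‖x‖) x :=
        ((hys j).contDiffAt (Ioi_mem_nhds hx)).comp x hn
      have hχx : ContDiffAt ℝ (⊤ : ℕ∞) (fun x : Space => χ ‖x‖) x := hχs.contDiffAt.comp x hn
      have hinv : ContDiffAt ℝ (⊤ : ℕ∞) (fun x : Space => (‖x‖ ^ (j + 1))⁻¹) x :=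
        (hn.pow _).inv (pow_ne_zero _ (by positivity))
      exact ContDiffAt.mul (((innerSL ℝ ξ).contDiff.pow j).contDiffAt) ((hχx.mul hyx).mul hinv)
    · have : f j =ᶠ[𝓝 x] fun _ => 0 := by
        filter_upwards [continuous_norm.continuousAt.eventually
          (gt_mem_nhds (show ‖x‖ < 1 by linarith))] with x' hx'
        exact hf1 j x' hx'.le
      exact contDiffAt_const.congr_of_eventuallyEq this
  have hφs : ContDiff ℝ (⊤ : ℕ∞) φ := ContDiff.sum fun j _ => hfs j
  have hterm : ∀ (g : ℕ → ℝ → ℝ) (D : ℝ) (x : Space), 1 ≤ ‖x‖ → (∀ j, |g j ‖x‖| ≤ D) →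
      |∑ j ∈ Finset.range (m + 1), inner ℝ ξ x ^ j * (g j ‖x‖ * (‖x‖ ^ (j + 1))⁻¹)|
        ≤ Sξ * D * ‖x‖⁻¹ := by
    intro g D x hx hg
    have hx0 : 0 < ‖x‖ := by linarith
    rw [hSξ, Finset.sum_mul, Finset.sum_mul]
    refine (Finset.abs_sum_le_sum_abs _ _).trans (Finset.sum_le_sum fun j _ => ?_)
    rw [abs_mul, abs_mul, abs_pow, abs_of_nonneg (inv_nonneg.2 (pow_nonneg hx0.le (j + 1)))]
    calc |inner ℝ ξ x| ^ j * (|g j ‖x‖| * (‖x‖ ^ (j + 1))⁻¹)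
        ≤ (‖ξ‖ * ‖x‖) ^ j * (D * (‖x‖ ^ (j + 1))⁻¹) := by
          gcongr
          · exact abs_real_inner_le_norm ξ x
          · exact hg j
      _ = _ := by
          rw [mul_pow]
          field_simp
          ring
  refine ⟨φ, e, hφs, ?_, hφ1, ?_, ?_, ?_⟩
  · refine HasCompactSupport.intro (isCompact_closedBall (0 : Space) (2 * L)) fun x hx => ?_
    rw [mem_closedBall_zero_iff, not_le] at hx
    exact Finset.sum_eq_zero fun j _ => by simp [hf, hz, hχzero _ hx.le]
  · intro x
    rcases eq_or_ne x 0 with rfl | hx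
    · have h1 : (Δ φ) 0 = 0 := by
        have : φ =ᶠ[𝓝 0] fun _ => (0 : ℝ) := by
          filter_upwards [ball_mem_nhds (0 : Space) one_pos] with x hx
          exact hφ1 x (mem_ball_zero_iff.1 hx).le
        rw [(InnerProductSpace.laplacian_congr_nhds this).self_of_nhds]
        simp
      have h2 : e 0 = 0 := Finset.sum_eq_zero fun j _ => by simp
      simp [h1, h2, hφ1 0 (by simp), hh1 0 zero_le_one]
    have hr0 : 0 < ‖x‖ := norm_pos_iff.2 hx
    set r := ‖x‖ with hr
    set t : ℝ := inner ℝ ξ x with ht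
    have hz2 : ∀ j, j ≤ m → HasDerivAt (z₁ j)
        (ε j r + χ r * (((r ^ 2)⁻¹ * ((j : ℝ) * (j + 1) * y j r
          - ((j : ℝ) + 2) * (j + 1) * ‖ξ‖ ^ 2 * y (j + 2) r)
          - (b / r + κ) * y j r + if j = m then r ^ (m + 1) * h r else 0))) r := by
      intro j hj
      rcases lt_or_ge (1 / 2) r with hr2 | hr2
      · refine (((hχd1 r).mul (hy j r)).add ((hχd r).mul (hv j r hj hr2))).congr_deriv ?_
        simp only [hε]
        ring
      · have hzero : z₁ j =ᶠ[𝓝 r] fun _ => 0 := by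
          filter_upwards [gt_mem_nhds (show r < 1 by linarith)] with s hs
          simp [hz1, hy1 j s hs.le]
        have hr1 : r ≤ 1 := by linarith
        refine ((hasDerivAt_const r (0 : ℝ)).congr_of_eventuallyEq hzero).congr_deriv ?_
        simp [hε, hy1 _ r hr1, hh1 r hr1]
    have hΔ : (Δ φ) x = ∑ j ∈ Finset.range (m + 1), (Δ (f j)) x := by
      have : ∀ s : Finset ℕ, (Δ (fun x => ∑ j ∈ s, f j x)) x = ∑ j ∈ s, (Δ (f j)) x := by
        intro s
        induction s using Finset.induction_on with
        | empty => simp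
        | insert a s ha ih =>
          rw [Finset.sum_insert ha, ← ih]
          have : (fun x => ∑ j ∈ insert a s, f j x) = f a + fun x => ∑ j ∈ s, f j x := by
            ext x; simp [Finset.sum_insert ha]
          rw [this, ContDiffAt.laplacian_add]
          · exact (contDiff_infty.1 (hfs a) 2).contDiffAt
          · exact (contDiff_infty.1 (ContDiff.sum fun j _ => hfs j) 2).contDiffAt
      exact this _
    have hΔj : ∀ j ∈ Finset.range (m + 1), (Δ (f j)) x
        = (j * (j - 1) * ‖ξ‖ ^ 2 * t ^ (j - 2) * (z j r * (r ^ (j + 1))⁻¹))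
          + (t ^ j * (ε j r * (r ^ (j + 1))⁻¹) - (b / r + κ) * f j x
            - ((j : ℝ) + 2) * (j + 1) * ‖ξ‖ ^ 2 * t ^ j * (z (j + 2) r * (r ^ (j + 3))⁻¹)
            + if j = m then h r * t ^ m else 0) := by
      intro j hj
      have hj' : j ≤ m := by simpa [Nat.lt_succ_iff] using hj
      rw [laplacian_moment ξ j hx (hzd j) (hz2 j hj')]
      rw [← hr, ← ht]
      congr 1
      -- The source lives inside radius `R ≤ L`, where the cutoff equals `1`.
      have hχh : χ r * h r = h r := by
        rcases le_total r L with h | h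
        · rw [hχone r h, one_mul]
        · rw [hR r (hRL.trans h), mul_zero]
      have hfx : f j x = t ^ j * (z j r * (r ^ (j + 1))⁻¹) := rfl
      rw [hfx]
      split_ifs with hjm
      · subst hjm
        have h3 : t ^ j * h r = t ^ j * (r ^ (j + 1))⁻¹ * (r ^ (j + 1) * (χ r * h r)) := by
          rw [hχh]
          field_simp
        rw [mul_comm (h r), h3]
        simp only [hz]
        field_simp
        ring
      · simp only [hz]
        field_simp
        ring
    -- The degree-lowering part of the Laplacian in degree `j + 2` cancels the off-diagonal coupling
    -- in degree `j`. At the ends, `j * (j - 1)` vanishes for `j = 0, 1`, and `y j` vanishes for `j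
    -- > m`.
    have hshift : ∑ j ∈ Finset.range (m + 1),
          ((j : ℝ) * (j - 1) * ‖ξ‖ ^ 2 * t ^ (j - 2) * (z j r * (r ^ (j + 1))⁻¹))
        = ∑ j ∈ Finset.range (m + 1),
          (((j : ℝ) + 2) * (j + 1) * ‖ξ‖ ^ 2 * t ^ j * (z (j + 2) r * (r ^ (j + 3))⁻¹)) := by
      set a : ℕ → ℝ := fun j =>
        (j : ℝ) * (j - 1) * ‖ξ‖ ^ 2 * t ^ (j - 2) * (z j r * (r ^ (j + 1))⁻¹) with ha
      have ha2 : ∀ j, a (j + 2)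
          = ((j : ℝ) + 2) * (j + 1) * ‖ξ‖ ^ 2 * t ^ j * (z (j + 2) r * (r ^ (j + 3))⁻¹) := by
        intro j
        simp only [ha, Nat.add_sub_cancel]
        push_cast
        ring
      have hlast : ∀ j, m < j → a j = 0 := fun j hj => by simp [ha, hz, hym j r hj]
      have h1 : ∑ j ∈ Finset.range (m + 3), a j = ∑ j ∈ Finset.range (m + 1), a j := by
        rw [Finset.sum_range_succ, Finset.sum_range_succ, hlast (m + 2) (by omega),
          hlast (m + 1) (by omega), add_zero, add_zero]
      rw [← h1, Finset.sum_range_succ', Finset.sum_range_succ']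
      simp only [add_assoc, Nat.reduceAdd, ha2]
      simp [ha]
    rw [hΔ, Finset.sum_congr rfl hΔj, Finset.sum_add_distrib, hshift]
    simp only [Finset.sum_add_distrib, Finset.sum_sub_distrib, ← Finset.mul_sum]
    rw [Finset.sum_ite_eq' (Finset.range (m + 1)) m, if_pos (by simp)]
    simp only [hφ, he, ← hr, ← ht]
    ring
  · intro x
    rcases le_or_gt ‖x‖ 1 with hx | hx
    · rw [hφ1 x hx, abs_zero]
      exact mul_nonneg (by positivity) (truncatedInv_nonneg _ _)
    · rcases le_or_gt ‖x‖ (2 * L) with hx2 | hx2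
      · rw [truncatedInv, if_pos hx2]
        refine (hterm z C x hx.le fun j => ?_).trans ?_
        · rw [hz]
          simp only
          rw [abs_mul]
          exact (mul_le_mul (hχle _) (hC j _ hx.le).1 (abs_nonneg _) zero_le_one).trans
            (one_mul C).le
        · gcongr
          nlinarith [mul_nonneg hc0 hC0]
      · have : φ x = 0 := Finset.sum_eq_zero fun j _ => by simp [hf, hz, hχzero _ hx2.le]
        rw [this, abs_zero]
        exact mul_nonneg (by positivity) (truncatedInv_nonneg _ _)
  · intro x
    rcases le_or_gt ‖x‖ 1 with hx | hx
    · have : e x = 0 := Finset.sum_eq_zero fun j _ => by simp [hε, hy1 j _ hx]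
      rw [this, abs_zero]
      exact mul_nonneg (by positivity) (truncatedInv_nonneg _ _)
    · rcases le_or_gt ‖x‖ (2 * L) with hx2 | hx2
      · rw [truncatedInv, if_pos hx2]
        refine (hterm ε (3 * c * C / L) x hx.le fun j => ?_).trans ?_
        · have h1 := hC j _ hx.le
          calc |ε j ‖x‖| ≤ |χ₂ ‖x‖ * y j ‖x‖| + |2 * (χ₁ ‖x‖ * v j ‖x‖)| := abs_add_le _ _
            _ = |χ₂ ‖x‖| * |y j ‖x‖| + 2 * (|χ₁ ‖x‖| * |v j ‖x‖|) := by
              rw [abs_mul, abs_mul, abs_mul, abs_two]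
            _ ≤ c / L * C + 2 * (c / L * C) := by
              gcongr
              · exact hχ2 _
              · exact h1.1
              · exact hχ1 _
              · exact h1.2
            _ = 3 * c * C / L := by ring
        · rw [← mul_div_assoc]
          gcongr
          linarith
      · have : e x = 0 := Finset.sum_eq_zero fun j _ => by simp [hε, hχhigh _ hx2]
        rw [this, abs_zero]
        exact mul_nonneg (by positivity) (truncatedInv_nonneg _ _)

end TestFunctions

/-! ### Cauchy–Schwarz pairings and the weak form of the Laplacian. -/

section Pairing

lemma norm_integral_mul_le_sqrt {α : Type*} [MeasurableSpace α] {μ : Measure α} {f g : α → ℂ}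
    (hf : MemLp f 2 μ) (hg : MemLp g 2 μ) :
    ‖∫ x, f x * g x ∂μ‖ ≤ √(∫ x, ‖f x‖ ^ 2 ∂μ) * √(∫ x, ‖g x‖ ^ 2 ∂μ) := by
  refine (norm_integral_le_integral_norm _).trans ?_
  simp only [norm_mul]
  have h2 : ENNReal.ofReal 2 = 2 := by norm_num
  have := integral_mul_norm_le_Lp_mul_Lq (μ := μ) (f := f) (g := g)
    (Real.HolderConjugate.two_two) (by rwa [h2]) (by rwa [h2])
  simpa [Real.sqrt_eq_rpow] using this

lemma integral_norm_sq_Lp {α : Type*} [MeasurableSpace α] {μ : Measure α} (u : Lp ℂ 2 μ) :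
    ∫ x, ‖u x‖ ^ 2 ∂μ = ‖u‖ ^ 2 := by
  have h : (inner ℂ u u : ℂ) = ((∫ x, ‖u x‖ ^ 2 ∂μ : ℝ) : ℂ) := by
    rw [L2.inner_def, ← integral_complex_ofReal]
    refine integral_congr_ae (Eventually.of_forall fun x => ?_)
    simp [inner_self_eq_norm_sq_to_K]
  rw [inner_self_eq_norm_sq_to_K] at h
  apply Complex.ofReal_injective
  rw [← h]
  simp

lemma integrable_truncatedInv_sq (ρ : ℝ) :
    Integrable (fun x : Space => truncatedInv ρ x ^ 2) := by
  have h := integrable_fun_norm_addHaar (E := Space) (volume : Measure Space)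
    (f := fun r : ℝ => (if r ≤ ρ then r⁻¹ else 0) ^ 2)
  refine h.2 ?_
  have hI : IntegrableOn (fun _ : ℝ => (1 : ℝ)) (Ioc 0 ρ) := by simp
  have hI' : IntegrableOn ((Ioc 0 ρ).indicator fun _ : ℝ => (1 : ℝ)) (Ioi 0) :=
    (hI.integrable_indicator measurableSet_Ioc).integrableOn
  refine hI'.congr_fun (fun r hr => ?_) measurableSet_Ioi
  have hr : (0 : ℝ) < r := hr
  by_cases h : r ≤ ρ
  · simp [h, hr]
    field_simp
  · simp [h]

lemma measurable_truncatedInv (ρ : ℝ) : Measurable (truncatedInv ρ) :=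
  Measurable.ite (measurableSet_le measurable_norm measurable_const) measurable_norm.inv
    measurable_const

/-- In dimension three the Jacobian `r ^ 2` cancels `|x| ^ (-2)`, so the integral grows only
linearly in the radius. The resulting norm `√L` of `1 / |x|` is beaten by the `1 / L` of the cutoff
error. -/
lemma exists_integral_truncatedInv_sq_eq :
    ∃ c : ℝ, 0 ≤ c ∧ ∀ ρ, 0 ≤ ρ → ∫ x : Space, truncatedInv ρ x ^ 2 = c * ρ := by
  refine ⟨3 * (volume : Measure Space).real (ball 0 1), by positivity, fun ρ hρ => ?_⟩
  have h := integral_fun_norm_addHaar (E := Space) (volume : Measure Space)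
    (fun r : ℝ => (if r ≤ ρ then r⁻¹ else 0) ^ 2)
  refine h.trans ?_
  have : ∫ y in Ioi (0 : ℝ), y ^ (Module.finrank ℝ Space - 1) • (if y ≤ ρ then y⁻¹ else 0) ^ 2
      = ∫ y in Ioi (0 : ℝ), (Ioc 0 ρ).indicator (fun _ : ℝ => (1 : ℝ)) y := by
    refine setIntegral_congr_fun measurableSet_Ioi fun r hr => ?_
    have hr : (0 : ℝ) < r := hr
    by_cases h : r ≤ ρ
    · simp [h, hr]
      field_simp
    · simp [h]
  rw [this, setIntegral_indicator measurableSet_Ioc]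
  have hinter : Ioi (0 : ℝ) ∩ Ioc 0 ρ = Ioc 0 ρ := by
    ext r; simp +contextual
  rw [hinter]
  simp [hρ, mul_assoc]

/-- Cauchy–Schwarz against a function dominated by a multiple of `|x|⁻¹` on a ball. -/
lemma norm_integral_mul_le_of_truncatedInv {c : ℝ} (hc : 0 ≤ c)
    (hc' : ∀ ρ, 0 ≤ ρ → ∫ x : Space, truncatedInv ρ x ^ 2 = c * ρ) {u : Space → ℂ}
    {f : Space → ℝ} {D ρ : ℝ} (hD : 0 ≤ D) (hρ : 0 ≤ ρ) (hu : MemLp u 2 volume)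
    (hf : AEStronglyMeasurable f volume) (hfD : ∀ x, |f x| ≤ D * truncatedInv ρ x) :
    MemLp (fun x => (f x : ℂ)) 2 volume ∧
    ‖∫ x, u x * f x‖ ≤ √(∫ x, ‖u x‖ ^ 2) * (D * √(c * ρ)) := by
  have hT : MemLp (truncatedInv ρ) 2 (volume : Measure Space) :=
    (memLp_two_iff_integrable_sq (measurable_truncatedInv ρ).aestronglyMeasurable).2
      (integrable_truncatedInv_sq ρ)
  have hfL : MemLp (fun x => (f x : ℂ)) 2 (volume : Measure Space) := by
    refine (hT.const_mul D).of_le (Complex.continuous_ofReal.comp_aestronglyMeasurable hf)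
      (Eventually.of_forall fun x => ?_)
    rw [Complex.norm_real, Real.norm_eq_abs, Real.norm_of_nonneg
      (mul_nonneg hD (truncatedInv_nonneg _ _))]
    exact hfD x
  refine ⟨hfL, (norm_integral_mul_le_sqrt hu hfL).trans ?_⟩
  gcongr
  rw [Real.sqrt_le_left (by positivity), mul_pow, Real.sq_sqrt (by positivity), ← hc' ρ hρ,
    ← integral_const_mul]
  refine integral_mono ?_ ((integrable_truncatedInv_sq ρ).const_mul _) fun x => ?_
  · exact (memLp_two_iff_integrable_sq_norm hfL.1).1 hfL
  · simp only
    rw [Complex.norm_real, Real.norm_eq_abs, ← mul_pow]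
    gcongr
    exact hfD x

/-- Weak formulation of `Δ u = g` for `u, g ∈ L²` against a real test function. -/
lemma integral_mul_laplacian_eq {u g : LTwo} (h : Δ (u : 𝓢'(Space, ℂ)) = (g : 𝓢'(Space, ℂ)))
    {φ : Space → ℝ} (hφ : ContDiff ℝ (⊤ : ℕ∞) φ) (hφc : HasCompactSupport φ) :
    ∫ x, u x * ((Δ φ) x : ℝ) = ∫ x, g x * (φ x : ℝ) := by
  set ψ : Space → ℂ := fun x => (φ x : ℂ) with hψ
  have hψs : ContDiff ℝ (⊤ : ℕ∞) ψ := Complex.ofRealCLM.contDiff.comp hφ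
  have hψc : HasCompactSupport ψ := hφc.comp_left (g := fun r : ℝ => (r : ℂ)) rfl
  set Ψ : 𝓢(Space, ℂ) := hψc.toSchwartzMap hψs with hΨ
  have hΨapp : ∀ x, Ψ x = φ x := fun x => rfl
  have hlap : ∀ x, (Δ Ψ) x = (((Δ φ) x : ℝ) : ℂ) := by
    intro x
    rw [SchwartzMap.laplacian_apply]
    exact ContDiffAt.laplacian_CLM_comp_left (l := Complex.ofRealCLM)
      (contDiff_infty.1 hφ 2).contDiffAt
  have h1 := congrArg (fun T : 𝓢'(Space, ℂ) => T Ψ) h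
  simp only [TemperedDistribution.laplacian_apply_apply, Lp.toTemperedDistribution_apply,
    smul_eq_mul, hlap, hΨapp] at h1
  simp only [mul_comm (u _), mul_comm (g _)]
  exact h1

end Pairing

/-! ### Estimates for moments, and vanishing of functions without moments. -/

section Rellich

open scoped FourierTransform

lemma continuous_laplacian {φ : Space → ℝ} (hφ : ContDiff ℝ (⊤ : ℕ∞) φ) : Continuous (Δ φ) := by
  rw [InnerProductSpace.laplacian_eq_iteratedFDeriv_stdOrthonormalBasis]
  have h2 : Continuous (iteratedFDeriv ℝ 2 φ) := (contDiff_infty.1 hφ 2).continuous_iteratedFDeriv'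
  refine continuous_finsetSum _ fun i _ => ?_
  exact (ContinuousMultilinearMap.apply ℝ (fun _ : Fin 2 => Space) ℝ _).continuous.comp h2

/-- Quantitative absence of outgoing moments: if `(Δ + b / |x| + κ) u = F - i δ u` outside the unit
ball and `F` is supported in the ball of radius `R`, the moments of `u` on the shell are controlled
by `F` and `√L (δ + 1 / L) ‖u‖`. -/
lemma exists_norm_integral_moment_le (ξ : Space) (m : ℕ) {b κ : ℝ} (hb : 0 ≤ b) (hκ : 0 < κ)
    {h : ℝ → ℝ} (hh : ContDiff ℝ (⊤ : ℕ∞) h) (hh1 : ∀ r ≤ 1, h r = 0) {R : ℝ} (hR0 : 0 ≤ R)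
    (hR : ∀ r, R ≤ r → h r = 0) :
    ∃ K : ℝ, 0 ≤ K ∧ ∀ L, 1 ≤ L → R ≤ L → ∀ (u g : LTwo) (δ : ℝ) (F : Space → ℂ), 0 ≤ δ →
      Δ (u : 𝓢'(Space, ℂ)) = (g : 𝓢'(Space, ℂ)) → MemLp F 2 volume →
      (∀ x, x ∉ ball (0 : Space) R → F x = 0) →
      (∀ᵐ x : Space, 1 < ‖x‖ →
        g x + ((b / ‖x‖ + κ : ℝ) : ℂ) * u x = F x - Complex.I * δ * u x) →
      ‖∫ x, u x * ((h ‖x‖ * inner ℝ ξ x ^ m : ℝ) : ℂ)‖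
        ≤ K * (√L * (δ + 1 / L) * ‖u‖ + √(∫ x, ‖F x‖ ^ 2)) := by
  obtain ⟨C, hC0, hC⟩ := exists_helmholtz_test ξ m hb hκ hh hh1 hR
  obtain ⟨c, hc0, hc⟩ := exists_integral_truncatedInv_sq_eq
  refine ⟨C * √c * (√2 + √R), by positivity, fun L hL hRL u g δ F hδ hug hF hFs heq => ?_⟩
  obtain ⟨φ, e, hφ, hφc, hφ1, hφe, hφb, heb⟩ := hC L hL hRL
  have hL0 : 0 < L := by linarith
  have hL2 : (0 : ℝ) ≤ 2 * L := by positivity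
  have hu : MemLp u 2 volume := Lp.memLp u
  have hg : MemLp g 2 volume := Lp.memLp g
  have hun : √(∫ x, ‖u x‖ ^ 2) = ‖u‖ := by
    rw [integral_norm_sq_Lp, Real.sqrt_sq (norm_nonneg _)]
  set P : Space → ℝ := fun x => h ‖x‖ * inner ℝ ξ x ^ m with hP
  have hPc : Continuous P :=
    (hh.continuous.comp continuous_norm).mul ((innerSL ℝ ξ).continuous.pow m)
  set q : Space → ℝ := fun x => (b / ‖x‖ + κ) * φ x with hq
  have hqm : AEStronglyMeasurable q volume :=
    (Measurable.mul (by fun_prop) hφ.continuous.measurable).aestronglyMeasurable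
  have hem : AEStronglyMeasurable e volume := by
    have : e = fun x => (Δ φ) x + q x - P x := by
      ext x; rw [hq, hP]; linarith [hφe x]
    rw [this]
    exact (((continuous_laplacian hφ).aestronglyMeasurable).add hqm).sub
      hPc.aestronglyMeasurable
  have hqb : ∀ x, |q x| ≤ ((b + κ) * C) * truncatedInv (2 * L) x := by
    intro x
    rcases le_or_gt ‖x‖ 1 with hx | hx
    · rw [hq]; simp only [hφ1 x hx, mul_zero, abs_zero]
      exact mul_nonneg (by positivity) (truncatedInv_nonneg _ _)
    · rw [hq]
      simp only
      rw [abs_mul, mul_assoc, abs_of_nonneg (by positivity)]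
      gcongr
      · exact div_le_self hb hx.le
      · exact hφb x
  obtain ⟨hφL, hφu⟩ := norm_integral_mul_le_of_truncatedInv hc0 hc hC0 hL2 hu
    hφ.continuous.aestronglyMeasurable hφb
  obtain ⟨hqL, -⟩ := norm_integral_mul_le_of_truncatedInv hc0 hc
    (by positivity : 0 ≤ (b + κ) * C) hL2 hu hqm hqb
  obtain ⟨heL, heu⟩ := norm_integral_mul_le_of_truncatedInv hc0 hc
    (by positivity : 0 ≤ C / L) hL2 hu hem heb
  -- As `F` lives in the ball of radius `R`, only this part of `φ` meets it. Its norm is of order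
  -- `√R` rather than `√L`, which keeps `K` independent of `L`.
  set φR : Space → ℝ := (ball (0 : Space) R).indicator φ with hφR
  have hφRb : ∀ x, |φR x| ≤ C * truncatedInv R x := by
    intro x
    by_cases hx : x ∈ ball (0 : Space) R
    · rw [hφR, indicator_of_mem hx]
      have hx' : ‖x‖ ≤ R := (mem_ball_zero_iff.1 hx).le
      have := hφb x
      rwa [truncatedInv, if_pos (by linarith), ← if_pos (c := ‖x‖ ≤ R) (t := ‖x‖⁻¹) (e := 0) hx',
        ← truncatedInv] at this
    · rw [hφR, indicator_of_notMem hx, abs_zero]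
      exact mul_nonneg hC0 (truncatedInv_nonneg _ _)
  obtain ⟨hφRL, hφRF⟩ := norm_integral_mul_le_of_truncatedInv hc0 hc hC0 hR0 hF
    (hφ.continuous.aestronglyMeasurable.indicator measurableSet_ball) hφRb
  have hFφ : ∀ x, F x * (φR x : ℂ) = F x * (φ x : ℂ) := by
    intro x
    by_cases hx : x ∈ ball (0 : Space) R
    · rw [hφR, indicator_of_mem hx]
    · rw [hFs x hx, zero_mul, zero_mul]
  have hlapL : MemLp (fun x => (((Δ φ) x : ℝ) : ℂ)) 2 volume := by
    refine Continuous.memLp_of_hasCompactSupport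
      (Complex.continuous_ofReal.comp (continuous_laplacian hφ)) ?_
    refine HasCompactSupport.comp_left (g := fun r : ℝ => (r : ℂ)) (f := Δ φ) ?_ rfl
    refine hφc.mono' fun x hx => ?_
    by_contra hx'
    refine hx ?_
    have : φ =ᶠ[𝓝 x] fun _ => (0 : ℝ) := notMem_tsupport_iff_eventuallyEq.1 hx'
    rw [(InnerProductSpace.laplacian_congr_nhds this).self_of_nhds]
    simp
  have i1 : Integrable (fun x => u x * (((Δ φ) x : ℝ) : ℂ)) := hu.integrable_mul hlapL
  have i2 : Integrable (fun x => u x * (q x : ℂ)) := hu.integrable_mul hqL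
  have i3 : Integrable (fun x => u x * (e x : ℂ)) := hu.integrable_mul heL
  have i4 : Integrable (fun x => g x * (φ x : ℂ)) := hg.integrable_mul hφL
  have i5 : Integrable (fun x => F x * (φ x : ℂ)) := hF.integrable_mul hφL
  have i6 : Integrable (fun x => u x * (φ x : ℂ)) := hu.integrable_mul hφL
  have hmain : ∫ x, u x * (P x : ℂ)
      = (∫ x, F x * (φR x : ℂ)) - Complex.I * δ * (∫ x, u x * (φ x : ℂ))
        - ∫ x, u x * (e x : ℂ) := by
    have e1 : ∀ x, u x * (P x : ℂ)
        = u x * (((Δ φ) x : ℝ) : ℂ) + u x * (q x : ℂ) - u x * (e x : ℂ) := by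
      intro x
      have : P x = (Δ φ) x + q x - e x := by rw [hq, hP]; linarith [hφe x]
      rw [this]
      push_cast
      ring
    have e2 : ∫ x, (g x * (φ x : ℂ) + u x * (q x : ℂ))
        = ∫ x, (F x * (φ x : ℂ) - Complex.I * δ * (u x * (φ x : ℂ))) := by
      refine integral_congr_ae ?_
      filter_upwards [heq] with x hx
      rcases le_or_gt ‖x‖ 1 with hx1 | hx1
      · simp [hq, hφ1 x hx1]
      · have := hx hx1
        calc g x * (φ x : ℂ) + u x * (q x : ℂ)
            = (g x + ((b / ‖x‖ + κ : ℝ) : ℂ) * u x) * φ x := by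
              rw [hq]; push_cast; ring
          _ = _ := by rw [this]; ring
    have i12 : Integrable (fun x => u x * (((Δ φ) x : ℝ) : ℂ) + u x * (q x : ℂ)) := i1.add i2
    simp_rw [e1, hFφ]
    rw [integral_sub i12 i3, integral_add i1 i2, integral_mul_laplacian_eq hug hφ hφc,
      ← integral_add i4 i2, e2, integral_sub i5 (i6.const_mul _), integral_const_mul]
  change ‖∫ x, u x * (P x : ℂ)‖ ≤ _
  rw [hmain]
  rw [hun] at hφu heu
  have hs : √(c * (2 * L)) = √c * (√2 * √L) := by
    rw [Real.sqrt_mul hc0, Real.sqrt_mul zero_le_two]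
  have hsR : √(c * R) = √c * √R := Real.sqrt_mul hc0 _
  rw [hs] at hφu heu
  rw [hsR] at hφRF
  calc ‖(∫ x, F x * (φR x : ℂ)) - Complex.I * δ * (∫ x, u x * (φ x : ℂ))
        - ∫ x, u x * (e x : ℂ)‖
      ≤ ‖∫ x, F x * (φR x : ℂ)‖ + ‖Complex.I * δ * (∫ x, u x * (φ x : ℂ))‖
        + ‖∫ x, u x * (e x : ℂ)‖ :=
        (norm_sub_le _ _).trans (add_le_add (norm_sub_le _ _) le_rfl)
    _ ≤ √(∫ x, ‖F x‖ ^ 2) * (C * (√c * √R)) + δ * (‖u‖ * (C * (√c * (√2 * √L))))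
        + ‖u‖ * (C / L * (√c * (√2 * √L))) := by
        gcongr
        rw [norm_mul, norm_mul, Complex.norm_I, one_mul, Complex.norm_real,
          Real.norm_of_nonneg hδ]
        gcongr
    _ = C * √c * √R * √(∫ x, ‖F x‖ ^ 2) + C * √c * √2 * (√L * (δ + 1 / L) * ‖u‖) := by ring
    _ ≤ C * √c * (√2 + √R) * √(∫ x, ‖F x‖ ^ 2)
        + C * √c * (√2 + √R) * (√L * (δ + 1 / L) * ‖u‖) := by
        gcongr
        · linarith [Real.sqrt_nonneg 2]
        · linarith [Real.sqrt_nonneg R]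
    _ = _ := by ring

/-- A boundedly supported integrable function all of whose polynomial moments vanish is zero. -/
lemma ae_eq_zero_of_moments_eq_zero {F : Space → ℂ} (hF : Integrable F) {R : ℝ}
    (hFs : ∀ x, x ∉ ball (0 : Space) R → F x = 0)
    (hm : ∀ (ξ : Space) (m : ℕ), ∫ x, F x * ((inner ℝ ξ x ^ m : ℝ) : ℂ) = 0) :
    ∀ᵐ x, F x = 0 := by
  -- Expand the exponential in powers of `⟪ξ, x⟫`. Bounded support dominates the terms by `(2 π |ξ|
  -- |R|) ^ n / n!`, so integration term by term is allowed and every term is a moment.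
  have hfourier : ∀ ξ : Space, (𝓕 F : Space → ℂ) ξ = 0 := by
    intro ξ
    set T : ℕ → Space → ℂ := fun n x =>
      ((-2 * Real.pi * Complex.I) ^ n / n.factorial) * (F x * ((inner ℝ ξ x ^ n : ℝ) : ℂ)) with hT
    have hbound : ∀ n x, ‖F x * ((inner ℝ ξ x ^ n : ℝ) : ℂ)‖ ≤ ‖F x‖ * (‖ξ‖ * |R|) ^ n := by
      intro n x
      by_cases hx : x ∈ ball (0 : Space) R
      · have hx' : ‖x‖ ≤ |R| := (mem_ball_zero_iff.1 hx).le.trans (le_abs_self R)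
        rw [norm_mul, Complex.norm_real, Real.norm_eq_abs, abs_pow]
        gcongr
        exact (abs_real_inner_le_norm ξ x).trans (by gcongr)
      · simp [hFs x hx]
    have hint : ∀ n, Integrable (fun x => F x * ((inner ℝ ξ x ^ n : ℝ) : ℂ)) := by
      intro n
      refine Integrable.mono' (hF.norm.mul_const ((‖ξ‖ * |R|) ^ n)) (hF.1.mul ?_)
        (Eventually.of_forall (hbound n))
      exact (Complex.continuous_ofReal.comp
        ((innerSL ℝ ξ).continuous.pow n)).aestronglyMeasurable
    have hTint : ∀ n, Integrable (T n) := fun n => (hint n).const_mul _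
    have hsum : Summable fun n => ∫ x, ‖T n x‖ := by
      refine Summable.of_nonneg_of_le (fun n => integral_nonneg fun x => norm_nonneg _)
        (fun n => ?_) ((Real.summable_pow_div_factorial (2 * Real.pi * (‖ξ‖ * |R|))).mul_left
          (∫ x, ‖F x‖))
      calc ∫ x, ‖T n x‖ ≤ ∫ x, ((2 * Real.pi) ^ n / n.factorial) * (‖F x‖ * (‖ξ‖ * |R|) ^ n) := by
            refine integral_mono (hTint n).norm ((hF.norm.mul_const _).const_mul _) fun x => ?_
            simp only [hT]
            rw [norm_mul, norm_div, norm_pow]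
            have h1 : ‖(-2 * Real.pi * Complex.I : ℂ)‖ = 2 * Real.pi := by
              simp [abs_of_pos Real.pi_pos]
            rw [h1, Complex.norm_natCast]
            gcongr
            exact hbound n x
        _ = _ := by
            rw [integral_const_mul, integral_mul_const, mul_pow (2 * Real.pi)]
            ring
    have h1 := hasSum_integral_of_summable_integral_norm hTint hsum
    have h2 : (fun n => ∫ x, T n x) = fun _ => 0 := by
      funext n
      simp only [hT]
      rw [integral_const_mul, hm ξ n, mul_zero]
    rw [h2] at h1
    rw [Real.fourier_eq', ← h1.unique hasSum_zero]
    refine integral_congr_ae (Eventually.of_forall fun x => ?_)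
    simp only [smul_eq_mul]
    rw [Complex.exp_eq_exp_ℂ, NormedSpace.exp_eq_tsum_div]
    simp only
    rw [← tsum_mul_right]
    refine tsum_congr fun n => ?_
    simp only [hT]
    rw [real_inner_comm]
    push_cast
    ring
  -- Injectivity of the Fourier transform on integrable functions, by duality: each test function is
  -- the transform of a Schwartz function `X`, and the transform can be moved from `X` to `F`.
  refine ae_eq_zero_of_integral_contDiff_smul_eq_zero hF.locallyIntegrable fun g hg hgc => ?_
  set ψ : Space → ℂ := fun x => (g x : ℂ) with hψ
  have hψs : ContDiff ℝ (⊤ : ℕ∞) ψ := Complex.ofRealCLM.contDiff.comp hg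
  have hψc : HasCompactSupport ψ := hgc.comp_left (g := fun r : ℝ => (r : ℂ)) rfl
  set Ψ : 𝓢(Space, ℂ) := hψc.toSchwartzMap hψs with hΨ
  set X : 𝓢(Space, ℂ) := 𝓕⁻ Ψ with hX
  have hXΨ : ∀ x, (𝓕 (X : Space → ℂ) : Space → ℂ) x = g x := by
    intro x
    rw [← SchwartzMap.fourier_coe, hX, FourierTransform.fourier_fourierInv_eq]
    rfl
  have : ∫ ξ, (𝓕 F : Space → ℂ) ξ • X ξ = ∫ x, F x • (𝓕 (X : Space → ℂ) : Space → ℂ) x := by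
    simpa using! VectorFourier.integral_fourierIntegral_smul_eq_flip (L := innerₗ Space)
      Real.continuous_fourierChar continuous_inner hF X.integrable
  simp only [hfourier, hXΨ, zero_smul, integral_zero] at this
  rw [this]
  refine integral_congr_ae (Eventually.of_forall fun x => ?_)
  simp [mul_comm]

end Rellich

/-! ### Rellich's theorem and its boundary-value version. -/

section ShellUniqueness

/-- A smooth function which is nonzero exactly on `(1, R)`. -/
noncomputable def shellBump (R r : ℝ) : ℝ := expNegInvGlue (r - 1) * expNegInvGlue (R - r)

lemma contDiff_shellBump (R : ℝ) : ContDiff ℝ (⊤ : ℕ∞) (shellBump R) :=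
  (expNegInvGlue.contDiff.comp (by fun_prop)).mul (expNegInvGlue.contDiff.comp (by fun_prop))

lemma shellBump_of_le_one (R : ℝ) {r : ℝ} (hr : r ≤ 1) : shellBump R r = 0 := by
  rw [shellBump, expNegInvGlue.zero_of_nonpos (by linarith), zero_mul]

lemma shellBump_of_ge {R r : ℝ} (hr : R ≤ r) : shellBump R r = 0 := by
  rw [shellBump, expNegInvGlue.zero_of_nonpos (x := R - r) (by linarith), mul_zero]

lemma shellBump_ne_zero {R r : ℝ} (h1 : 1 < r) (hR : r < R) : shellBump R r ≠ 0 :=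
  mul_ne_zero (expNegInvGlue.pos_of_pos (by linarith)).ne'
    (expNegInvGlue.pos_of_pos (by linarith)).ne'

lemma memLp_shellBump_moment (R : ℝ) (ξ : Space) (m : ℕ) :
    MemLp (fun x : Space => ((shellBump R ‖x‖ * inner ℝ ξ x ^ m : ℝ) : ℂ)) 2 volume := by
  refine Continuous.memLp_of_hasCompactSupport (Complex.continuous_ofReal.comp
    (((contDiff_shellBump R).continuous.comp continuous_norm).mul
      ((innerSL ℝ ξ).continuous.pow m))) ?_
  refine HasCompactSupport.intro (isCompact_closedBall (0 : Space) R) fun x hx => ?_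
  rw [mem_closedBall_zero_iff, not_le] at hx
  simp [shellBump_of_ge hx.le]

lemma indicator_mul_shellBump (R : ℝ) (w : Space → ℂ) (t : ℝ) (x : Space) :
    (ball (0 : Space) R).indicator w x * ((shellBump R ‖x‖ * t : ℝ) : ℂ)
      = w x * ((shellBump R ‖x‖ * t : ℝ) : ℂ) := by
  by_cases hx : x ∈ ball (0 : Space) R
  · rw [indicator_of_mem hx]
  · rw [mem_ball_zero_iff, not_lt] at hx
    simp [shellBump_of_ge hx]

/-- The product of `w` with the bump is boundedly supported and has no moments, hence is zero; the
bump has no zeros inside the shell and can be divided out. -/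
lemma ae_eq_zero_on_shell {R : ℝ} {w : Space → ℂ}
    (hw : MemLp w 2 (volume.restrict (ball (0 : Space) R)))
    (hm : ∀ (ξ : Space) (m : ℕ), ∫ x, (ball (0 : Space) R).indicator w x
      * ((shellBump R ‖x‖ * inner ℝ ξ x ^ m : ℝ) : ℂ) = 0) :
    ∀ᵐ x : Space, x ∈ ball (0 : Space) R → 1 < ‖x‖ → w x = 0 := by
  have hwi : MemLp ((ball (0 : Space) R).indicator w) 2 volume :=
    (memLp_indicator_iff_restrict measurableSet_ball).2 hw
  have h := ae_eq_zero_of_moments_eq_zero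
    (F := fun x => (ball (0 : Space) R).indicator w x * ((shellBump R ‖x‖ : ℝ) : ℂ)) (R := R) ?_
    (fun x hx => by simp [indicator_of_notMem hx]) ?_
  · filter_upwards [h] with x hx hxR hx1
    rw [indicator_of_mem hxR] at hx
    exact (mul_eq_zero.1 hx).resolve_right
      (Complex.ofReal_ne_zero.2 (shellBump_ne_zero hx1 (mem_ball_zero_iff.1 hxR)))
  · have : Integrable fun x => (ball (0 : Space) R).indicator w x
        * ((shellBump R ‖x‖ * inner ℝ (0 : Space) x ^ 0 : ℝ) : ℂ) :=
      hwi.integrable_mul (memLp_shellBump_moment R 0 0)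
    simpa using this
  · intro ξ m
    rw [← hm ξ m]
    refine integral_congr_ae (Eventually.of_forall fun x => ?_)
    simp only
    push_cast
    ring

/-- **Rellich's theorem** for the Coulomb–Helmholtz equation in the exterior of the unit ball: at
positive energy there are no nonzero square integrable solutions. -/
theorem ae_eq_zero_of_exterior_helmholtz {b κ : ℝ} (hb : 0 ≤ b) (hκ : 0 < κ) {u g : LTwo}
    (hug : Δ (u : 𝓢'(Space, ℂ)) = (g : 𝓢'(Space, ℂ)))
    (heq : ∀ᵐ x : Space, 1 < ‖x‖ → g x + ((b / ‖x‖ + κ : ℝ) : ℂ) * u x = 0) :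
    ∀ᵐ x : Space, 1 < ‖x‖ → u x = 0 := by
  have key : ∀ R : ℕ, ∀ᵐ x : Space, x ∈ ball (0 : Space) R → 1 < ‖x‖ → u x = 0 := by
    intro R
    refine ae_eq_zero_on_shell ((Lp.memLp u).restrict _) fun ξ m => ?_
    obtain ⟨K, hK0, hK⟩ := exists_norm_integral_moment_le ξ m hb hκ (contDiff_shellBump R)
      (fun r hr => shellBump_of_le_one R hr) (Nat.cast_nonneg R) (fun r hr => shellBump_of_ge hr)
    simp_rw [indicator_mul_shellBump]
    -- With `δ = 0` and `F = 0` the moment estimate reads `K * L ^ (-1/2) * ‖u‖`.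
    refine norm_le_zero_iff.1 (ge_of_tendsto (x := atTop)
      (f := fun L : ℝ => K * ((√L)⁻¹ * ‖u‖)) ?_ ?_)
    · have h1 : Tendsto (fun L : ℝ => (√L)⁻¹) atTop (𝓝 0) :=
        tendsto_inv_atTop_zero.comp Real.tendsto_sqrt_atTop
      simpa using (h1.mul_const ‖u‖).const_mul K
    · filter_upwards [eventually_ge_atTop (1 : ℝ), eventually_ge_atTop (R : ℝ)] with L hL1 hLR
      have h := hK L hL1 hLR u g 0 0 le_rfl hug MemLp.zero (fun x _ => rfl)
        (by filter_upwards [heq] with x hx hx1; simpa using hx hx1)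
      refine h.trans (le_of_eq ?_)
      have hs : √L * (1 / L) = (√L)⁻¹ := by
        have hL0 : 0 < L := by linarith
        have := Real.sq_sqrt hL0.le
        have h0 : √L ≠ 0 := (Real.sqrt_pos.2 hL0).ne'
        field_simp
        linarith
      rw [zero_add, hs]
      simp
  have hall := ae_all_iff.2 key
  filter_upwards [hall] with x hx hx1
  obtain ⟨n, hn⟩ := exists_nat_gt ‖x‖
  exact hx n (mem_ball_zero_iff.2 hn) hx1

lemma sqrt_integral_norm_sq_eq {α : Type*} [MeasurableSpace α] {μ : Measure α} {f : α → ℂ}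
    (hf : MemLp f 2 μ) : √(∫ x, ‖f x‖ ^ 2 ∂μ) = (eLpNorm f 2 μ).toReal := by
  rw [hf.eLpNorm_eq_integral_rpow_norm (by norm_num) (by norm_num), ENNReal.toReal_ofReal]
  · rw [Real.sqrt_eq_rpow]
    norm_num
  · positivity

/-- Boundary-value version of Rellich's theorem: if `v δ` solve the Coulomb–Helmholtz equation at
energy `κ + i δ` outside the unit ball, up to a source in the ball of radius `a` proportional to
`v δ - w`, if `v δ → w` there, and if `δ ‖v δ‖² → 0` (no energy is radiated), then `w` vanishes
outside the unit ball. -/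
theorem ae_eq_zero_on_shell_of_no_flux {b κ a : ℝ} (hb : 0 ≤ b) (hκ : 0 < κ) (ha : 0 ≤ a)
    {w : Space → ℂ} (hw : MemLp w 2 (volume.restrict (ball (0 : Space) a))) (c : ℂ)
    {v g : ℝ → LTwo} (hvg : ∀ δ, 0 < δ → Δ (v δ : 𝓢'(Space, ℂ)) = (g δ : 𝓢'(Space, ℂ)))
    (heq : ∀ δ, 0 < δ → ∀ᵐ x : Space, 1 < ‖x‖ →
      g δ x + ((b / ‖x‖ + κ : ℝ) : ℂ) * v δ x
        = (ball (0 : Space) a).indicator (fun x => c * (v δ x - w x)) x - Complex.I * δ * v δ x)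
    (hlim : Tendsto (fun δ : ℝ =>
      eLpNorm (fun x => v δ x - w x) 2 (volume.restrict (ball (0 : Space) a))) (𝓝[>] 0) (𝓝 0))
    (hflux : Tendsto (fun δ : ℝ => δ * ‖v δ‖ ^ 2) (𝓝[>] 0) (𝓝 0)) :
    ∀ᵐ x : Space, x ∈ ball (0 : Space) a → 1 < ‖x‖ → w x = 0 := by
  set N : ℝ → ℝ := fun δ =>
    (eLpNorm (fun x => v δ x - w x) 2 (volume.restrict (ball (0 : Space) a))).toReal with hN
  have hN0 : Tendsto N (𝓝[>] 0) (𝓝 0) :=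
    (ENNReal.tendsto_toReal ENNReal.zero_ne_top).comp hlim
  set d : ℝ → Space → ℂ := fun δ => (ball (0 : Space) a).indicator fun x => v δ x - w x with hd
  have hdm : ∀ δ, MemLp (d δ) 2 volume := fun δ =>
    (memLp_indicator_iff_restrict measurableSet_ball).2 (((Lp.memLp (v δ)).restrict _).sub hw)
  have hdN : ∀ δ, √(∫ x, ‖d δ x‖ ^ 2) = N δ := by
    intro δ
    rw [sqrt_integral_norm_sq_eq (hdm δ), hd, eLpNorm_indicator_eq_eLpNorm_restrict
      measurableSet_ball]
  refine ae_eq_zero_on_shell hw fun ξ m => ?_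
  obtain ⟨K, hK0, hK⟩ := exists_norm_integral_moment_le ξ m hb hκ (contDiff_shellBump a)
    (fun r hr => shellBump_of_le_one a hr) ha (fun r hr => shellBump_of_ge hr)
  set P : Space → ℂ := fun x => ((shellBump a ‖x‖ * inner ℝ ξ x ^ m : ℝ) : ℂ) with hP
  have hPL : MemLp P 2 volume := memLp_shellBump_moment a ξ m
  set p : ℝ := √(∫ x, ‖P x‖ ^ 2) with hp
  refine norm_le_zero_iff.1 (ge_of_tendsto (x := 𝓝[>] (0 : ℝ))
    (f := fun δ : ℝ => K * (2 * √(δ * ‖v δ‖ ^ 2) + ‖c‖ * N δ) + N δ * p) ?_ ?_)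
  · have h1 := (hflux.sqrt).const_mul 2
    have h2 := ((h1.add (hN0.const_mul ‖c‖)).const_mul K).add (hN0.mul_const p)
    simpa using h2
  · have hev : ∀ᶠ δ : ℝ in 𝓝[>] 0, 0 < δ ∧ δ < (max 1 a)⁻¹ := by
      have : Ioo (0 : ℝ) (max 1 a)⁻¹ ∈ 𝓝[>] (0 : ℝ) := Ioo_mem_nhdsGT (by positivity)
      filter_upwards [this] with δ hδ using hδ
    filter_upwards [hev] with δ ⟨hδ, hδa⟩
    have hLa : max 1 a ≤ 1 / δ := by
      rw [one_div, le_inv_comm₀ (by positivity) hδ]; exact hδa.le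
    have hF : MemLp ((ball (0 : Space) a).indicator fun x => c * (v δ x - w x)) 2 volume :=
      (memLp_indicator_iff_restrict measurableSet_ball).2
        ((((Lp.memLp (v δ)).restrict _).sub hw).const_mul c)
    -- The choice `L = 1 / δ` balances the two errors: `√L * (δ + 1 / L) = 2 * √δ`, and the bound
    -- becomes the square root of the radiated energy.
    have h := hK (1 / δ) ((le_max_left _ _).trans hLa) ((le_max_right _ _).trans hLa) (v δ) (g δ) δ
      _ hδ.le (hvg δ hδ) hF (fun x hx => indicator_of_notMem hx _) (heq δ hδ)
    have hFn : √(∫ x, ‖(ball (0 : Space) a).indicator (fun x => c * (v δ x - w x)) x‖ ^ 2)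
        = ‖c‖ * N δ := by
      rw [← hdN, ← Real.sqrt_sq (norm_nonneg c), ← Real.sqrt_mul (sq_nonneg _),
        ← integral_const_mul]
      congr 1
      refine integral_congr_ae (Eventually.of_forall fun x => ?_)
      by_cases hx : x ∈ ball (0 : Space) a
      · simp [hd, hx, mul_pow]
      · simp [hd, hx]
    have hs : √(1 / δ) * (δ + 1 / (1 / δ)) * ‖v δ‖ = 2 * √(δ * ‖v δ‖ ^ 2) := by
      rw [Real.sqrt_mul hδ.le, Real.sqrt_sq (norm_nonneg _), one_div_one_div, one_div,
        Real.sqrt_inv]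
      have := Real.sq_sqrt hδ.le
      have h0 : √δ ≠ 0 := (Real.sqrt_pos.2 hδ).ne'
      field_simp
      rw [this]
      ring
    rw [hFn, hs] at h
    have hsplit : ∫ x, (ball (0 : Space) a).indicator w x * P x
        = (∫ x, v δ x * P x) - ∫ x, d δ x * P x := by
      have j1 : Integrable fun x => v δ x * P x := (Lp.memLp (v δ)).integrable_mul hPL
      have j2 : Integrable fun x => d δ x * P x := (hdm δ).integrable_mul hPL
      rw [← integral_sub j1 j2]
      refine integral_congr_ae (Eventually.of_forall fun x => ?_)
      simp only [hP, hd, indicator_mul_shellBump]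
      ring
    rw [hsplit]
    refine (norm_sub_le _ _).trans (add_le_add h ?_)
    rw [← hdN]
    exact norm_integral_mul_le_sqrt (hdm δ) hPL

end ShellUniqueness

/-! ### Symmetry of the Coulomb Hamiltonian. -/

section Energy

open scoped FourierTransform ComplexConjugate

/-- On the Fourier side the distributional Laplacian in `L²` is multiplication by `-(2π|ξ|)²`. -/
lemma fourier_laplacian_ae {u g : LTwo} (h : Δ (u : 𝓢'(Space, ℂ)) = (g : 𝓢'(Space, ℂ))) :
    ∀ᵐ ξ : Space, (𝓕 g : LTwo) ξ = ((-((2 * Real.pi) ^ 2 * ‖ξ‖ ^ 2) : ℝ) : ℂ) * (𝓕 u : LTwo) ξ := by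
  have htg : (fun x : Space => Complex.ofReal (‖x‖ ^ 2)).HasTemperateGrowth := by fun_prop
  have h1 : 𝓕 (g : 𝓢'(Space, ℂ)) = ((-(2 * Real.pi) ^ 2 : ℝ) : ℂ) • TemperedDistribution.smulLeftCLM ℂ
      (fun x : Space => Complex.ofReal (‖x‖ ^ 2)) (𝓕 (u : 𝓢'(Space, ℂ))) := by
    rw [← h, TemperedDistribution.laplacian_eq_fourierMultiplierCLM, ← Complex.coe_smul,
      TemperedDistribution.fourierMultiplierCLM_apply, FourierTransform.fourier_smul,
      FourierTransform.fourier_fourierInv_eq]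
  rw [Lp.fourier_toTemperedDistribution_eq, Lp.fourier_toTemperedDistribution_eq] at h1
  set U : LTwo := 𝓕 u
  set G : LTwo := 𝓕 g
  have hUl : LocallyIntegrable (U : Space → ℂ) := (Lp.memLp U).locallyIntegrable one_le_two
  have hGl : LocallyIntegrable (G : Space → ℂ) := (Lp.memLp G).locallyIntegrable one_le_two
  have hML : LocallyIntegrable fun x : Space =>
      ((-((2 * Real.pi) ^ 2 * ‖x‖ ^ 2) : ℝ) : ℂ) * U x := by
    have hc : Continuous fun x : Space => ((-((2 * Real.pi) ^ 2 * ‖x‖ ^ 2) : ℝ) : ℂ) := by fun_prop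
    rw [locallyIntegrable_iff]
    intro k hk
    exact ((locallyIntegrable_iff.1 hUl) k hk).continuousOn_mul hc.continuousOn hk
  have key := ae_eq_zero_of_integral_contDiff_smul_eq_zero (hGl.sub hML) fun φ hφ hφc => ?_
  · filter_upwards [key] with x hx
    exact sub_eq_zero.1 hx
  set ψ : Space → ℂ := fun x => (φ x : ℂ) with hψ
  have hψs : ContDiff ℝ (⊤ : ℕ∞) ψ := Complex.ofRealCLM.contDiff.comp hφ
  have hψc : HasCompactSupport ψ := hφc.comp_left (g := fun r : ℝ => (r : ℂ)) rfl
  set Ψ : 𝓢(Space, ℂ) := hψc.toSchwartzMap hψs with hΨ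
  have hΨapp : ∀ x, Ψ x = φ x := fun x => rfl
  have h2 := congrArg (fun T : 𝓢'(Space, ℂ) => T Ψ) h1
  simp only [Lp.toTemperedDistribution_apply, smul_apply,
    TemperedDistribution.smulLeftCLM_apply_apply, SchwartzMap.smulLeftCLM_apply_apply htg,
    smul_eq_mul, hΨapp] at h2
  have i1 := hGl.integrable_smul_left_of_hasCompactSupport hφ.continuous hφc
  have i2 := hML.integrable_smul_left_of_hasCompactSupport hφ.continuous hφc
  have e1 : ∫ x, φ x • G x = ∫ x, (φ x : ℂ) * G x :=
    integral_congr_ae (Eventually.of_forall fun x => by simp)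
  have e2 : ∫ x, φ x • (((-((2 * Real.pi) ^ 2 * ‖x‖ ^ 2) : ℝ) : ℂ) * U x)
      = ((-(2 * Real.pi) ^ 2 : ℝ) : ℂ) * ∫ x, ((‖x‖ ^ 2 : ℝ) : ℂ) * (φ x : ℂ) * U x := by
    rw [← integral_const_mul]
    refine integral_congr_ae (Eventually.of_forall fun x => ?_)
    simp only [Complex.real_smul]
    push_cast
    ring
  simp only [Pi.sub_apply, smul_sub]
  rw [integral_sub i1 i2, e1, e2, h2, sub_self]

/-- `⟨u, Δ u⟩` is real. -/
lemma inner_laplacian_im {u g : LTwo} (h : Δ (u : 𝓢'(Space, ℂ)) = (g : 𝓢'(Space, ℂ))) :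
    (∫ x, conj (u x) * g x).im = 0 := by
  have h1 : ∫ x, conj (u x) * g x = inner ℂ u g := by
    rw [L2.inner_def]
    refine integral_congr_ae (Eventually.of_forall fun x => ?_)
    simp [mul_comm]
  -- By Plancherel the pairing becomes the integral of a real multiplier against `|𝓕 u| ^ 2`.
  rw [h1, ← Lp.inner_fourier_eq, L2.inner_def]
  have h2 : ∫ ξ, inner ℂ ((𝓕 u : LTwo) ξ) ((𝓕 g : LTwo) ξ)
      = ((∫ ξ, -((2 * Real.pi) ^ 2 * ‖ξ‖ ^ 2) * ‖(𝓕 u : LTwo) ξ‖ ^ 2 : ℝ) : ℂ) := by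
    rw [← integral_complex_ofReal]
    refine integral_congr_ae ?_
    filter_upwards [fourier_laplacian_ae h] with ξ hξ
    rw [hξ, ← smul_eq_mul, inner_smul_right, inner_self_eq_norm_sq_to_K]
    push_cast
    rfl
  rw [h2, Complex.ofReal_im]

/-- The Coulomb Hamiltonian is symmetric: `⟨u, H_C u⟩` is real. -/
lemma HasCoulombImage.integral_conj_mul_im {b : ℝ} {u : LTwo} {h : Space → ℂ}
    (hu : HasCoulombImage b u h) (hh : MemLp h 2 volume) : (∫ x, conj (u x) * h x).im = 0 := by
  obtain ⟨-, g, hg, hgh⟩ := hu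
  have hcu : MemLp (fun x => conj (u x)) 2 volume := (Lp.memLp u).star
  -- No Hardy inequality is needed: the Coulomb term equals `-g - h`, and both of these are square
  -- integrable.
  have hV : MemLp (fun x : Space => ((b / ‖x‖ : ℝ) : ℂ) * u x) 2 volume := by
    refine MemLp.ae_eq ?_ ((Lp.memLp g).neg.sub hh)
    filter_upwards [hgh] with x hx
    simp [hx]
  have i1 : Integrable fun x => conj (u x) * g x := hcu.integrable_mul (Lp.memLp g)
  have i2 : Integrable fun x : Space => conj (u x) * (((b / ‖x‖ : ℝ) : ℂ) * u x) :=
    hcu.integrable_mul hV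
  have e1 : ∫ x, conj (u x) * h x
      = -(∫ x, conj (u x) * g x) - ∫ x, conj (u x) * (((b / ‖x‖ : ℝ) : ℂ) * u x) := by
    have i1' : Integrable fun x => -(conj (u x) * g x) := i1.neg
    rw [← integral_neg, ← integral_sub i1' i2]
    refine integral_congr_ae ?_
    filter_upwards [hgh] with x hx
    rw [hx]
    simp
    ring
  have e2 : ∫ x : Space, conj (u x) * (((b / ‖x‖ : ℝ) : ℂ) * u x)
      = ((∫ x : Space, b / ‖x‖ * ‖u x‖ ^ 2 : ℝ) : ℂ) := by
    rw [← integral_complex_ofReal]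
    refine integral_congr_ae (Eventually.of_forall fun x => ?_)
    simp only
    rw [mul_left_comm, Complex.conj_mul']
    push_cast
    rfl
  rw [e1, e2, Complex.sub_im, Complex.neg_im, inner_laplacian_im hg, Complex.ofReal_im]
  simp

end Energy

/-! ### The coupling term and the vanishing of the total flux. -/

section Coupling

open scoped ComplexConjugate

/-- The coefficients of an absolutely convergent real trigonometric series are conjugate
symmetric. -/
lemma conj_symm_of_real_trigonometric_series {ω : ℝ} (hω : 0 < ω) {A : ℤ → ℂ}
    (hA : Summable fun j => ‖A j‖)
    (him : ∀ t : ℝ, (∑' j : ℤ, A j * Complex.exp (Complex.I * j * ω * t)).im = 0) (k : ℤ) :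
    A (-k) = conj (A k) := by
  set T : ℝ := 2 * Real.pi / ω with hT
  have hT0 : 0 < T := by positivity
  have hωC : (ω : ℂ) ≠ 0 := Complex.ofReal_ne_zero.2 hω.ne'
  set e : ℤ → ℝ → ℂ := fun j t => Complex.exp (Complex.I * j * ω * t) with he
  have he1 : ∀ j t, ‖e j t‖ = 1 := by
    intro j t
    have : Complex.I * j * ω * t = ((j * ω * t : ℝ) : ℂ) * Complex.I := by push_cast; ring
    rw [he]
    simp only
    rw [this, Complex.norm_exp_ofReal_mul_I]
  have hec : ∀ j, Continuous (e j) := fun j => by simp only [he]; fun_prop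
  have hmul : ∀ i j t, e i t * e j t = e (i + j) t := by
    intro i j t
    simp only [he]
    rw [← Complex.exp_add]
    congr 1
    push_cast
    ring
  have hconj : ∀ j t, conj (e j t) = e (-j) t := by
    intro j t
    simp only [he]
    rw [← Complex.exp_conj]
    congr 1
    simp
  have hint : ∀ j : ℤ, ∫ t in Ioc 0 T, e j t = if j = 0 then (T : ℂ) else 0 := by
    intro j
    rw [← intervalIntegral.integral_of_le hT0.le]
    split_ifs with hj
    · subst hj
      simp [he]
    · have hc : Complex.I * j * ω ≠ 0 :=
        mul_ne_zero (mul_ne_zero Complex.I_ne_zero (Int.cast_ne_zero.2 hj)) hωC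
      simp only [he]
      rw [integral_exp_mul_complex hc]
      have : Complex.I * j * ω * T = j * (2 * Real.pi * Complex.I) := by
        rw [hT]; push_cast; field_simp
      rw [this, Complex.exp_int_mul_two_pi_mul_I]
      simp
  set f : ℝ → ℂ := fun t => ∑' j, A j * e j t with hf
  have hfreal : ∀ t, conj (f t) = f t := fun t => Complex.conj_eq_iff_im.2 (him t)
  -- Each coefficient is recovered by integrating over one period; since `f` is real, conjugating
  -- this formula relates `A k` to `A (-k)`.
  have hcoef : ∀ k, ∫ t in Ioc 0 T, f t * e (-k) t = A k * T := by
    intro k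
    have hi : ∀ j, Integrable (fun t => A j * e (j - k) t) (volume.restrict (Ioc 0 T)) := fun j =>
      ((continuous_const.mul (hec _)).integrableOn_Ioc)
    have h1 := integral_tsum_of_summable_integral_norm hi ?_
    · have h2 : ∀ t, ∑' j, A j * e (j - k) t = f t * e (-k) t := by
        intro t
        rw [hf]
        simp only
        rw [← tsum_mul_right]
        refine tsum_congr fun j => ?_
        rw [mul_assoc, hmul, sub_eq_add_neg]
      simp_rw [h2] at h1
      rw [← h1]
      simp_rw [integral_const_mul, hint]
      rw [tsum_eq_single k]
      · simp
      · intro j hj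
        rw [if_neg (sub_ne_zero.2 hj), mul_zero]
    · simp_rw [norm_mul, he1, mul_one]
      simpa using hA.mul_left (max T 0)
  have h1 := hcoef (-k)
  have h2 := congrArg conj (hcoef k)
  rw [← integral_conj] at h2
  simp only [map_mul, hfreal, hconj, Complex.conj_ofReal] at h2
  rw [h1] at h2
  exact mul_right_cancel₀ (Complex.ofReal_ne_zero.2 hT0.ne') h2

variable {ω : ℝ} {Ω : ℤ → Space → ℂ}

lemma ae_norm_ne_one : ∀ᵐ x : Space, ‖x‖ ≠ 1 := by
  have h := Measure.addHaar_sphere (volume : Measure Space) 0 1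
  rw [measure_eq_zero_iff_ae_notMem] at h
  filter_upwards [h] with x hx h1
  exact hx (mem_sphere_zero_iff_norm.2 h1)

/-- Continuity inside the ball and vanishing outside leave only the unit sphere, which is a null
set. -/
lemma IsForcing.aestronglyMeasurable (hΩ : IsForcing ω Ω) (j : ℤ) :
    AEStronglyMeasurable (Ω j) volume := by
  have h1 : AEStronglyMeasurable ((ball (0 : Space) 1).indicator (Ω j)) volume :=
    (aestronglyMeasurable_indicator_iff measurableSet_ball).2
      ((hΩ.smooth j).continuousOn.aestronglyMeasurable measurableSet_ball)
  refine h1.congr ?_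
  filter_upwards [ae_norm_ne_one] with x hx
  rcases lt_or_gt_of_ne hx with h | h
  · rw [indicator_of_mem (mem_ball_zero_iff.2 h)]
  · rw [indicator_of_notMem (by rw [mem_ball_zero_iff]; linarith), hΩ.support j x h]

/-- Summable uniform bounds for the Fourier coefficients of the forcing. -/
lemma IsForcing.exists_bound (hΩ : IsForcing ω Ω) :
    ∃ o : ℤ → ℝ, (∀ j, 0 ≤ o j) ∧ Summable o ∧ ∀ᵐ x : Space, ∀ j, ‖Ω j x‖ ≤ o j := by
  set N : ℤ → ℝ≥0∞ := fun j => eLpNorm (Ω j) ⊤ (volume.restrict (ball (0 : Space) 1)) with hN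
  have hle : ∑' j, N j ≤ ∑' j : ℤ, ENNReal.ofReal (1 + |(j : ℝ)|) * N j := by
    refine ENNReal.tsum_le_tsum fun j => ?_
    refine le_mul_of_one_le_left zero_le ?_
    rw [ENNReal.one_le_ofReal]
    linarith [abs_nonneg (j : ℝ)]
  have hfin : ∑' j, N j ≠ ⊤ := ne_top_of_le_ne_top hΩ.summable hle
  refine ⟨fun j => (N j).toReal, fun j => ENNReal.toReal_nonneg, ENNReal.summable_toReal hfin, ?_⟩
  rw [ae_all_iff]
  intro j
  have hj : N j ≠ ⊤ := ENNReal.ne_top_of_tsum_ne_top hfin j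
  have h1 : ∀ᵐ x ∂(volume.restrict (ball (0 : Space) 1)), ‖Ω j x‖ₑ ≤ N j := by
    simp only [hN, eLpNorm_exponent_top]
    exact enorm_ae_le_eLpNormEssSup _ _
  rw [ae_restrict_iff' measurableSet_ball] at h1
  filter_upwards [h1, ae_norm_ne_one] with x hx hx1
  rcases lt_or_gt_of_ne hx1 with h | h
  · have := (ENNReal.toReal_le_toReal enorm_ne_top hj).2 (hx (mem_ball_zero_iff.2 h))
    simpa using this
  · rw [hΩ.support j x h, norm_zero]
    exact ENNReal.toReal_nonneg

/-- The summable uniform bounds make the series in `t` absolutely convergent at almost every `x`,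
where reality of the potential determines its coefficients. -/
lemma IsForcing.ae_conj_symm (hΩ : IsForcing ω Ω) (hω : 0 < ω) :
    ∀ᵐ x : Space, ∀ j, Ω (-j) x = conj (Ω j x) := by
  obtain ⟨o, ho0, ho, hb⟩ := hΩ.exists_bound
  filter_upwards [hb] with x hx
  exact conj_symm_of_real_trigonometric_series hω
    (Summable.of_nonneg_of_le (fun j => norm_nonneg _) hx ho) fun t => hΩ.real_valued t x

lemma coupling_eq_zero (hΩ : IsForcing ω Ω) (w : ℤ → Space → ℂ) (n : ℤ) {x : Space}
    (hx : 1 < ‖x‖) : coupling Ω w n x = 0 := by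
  simp [coupling, hΩ.support _ x hx]

variable {a : ℝ} {w : ℤ → Space → ℂ}

lemma MemSeqSpace.summable_integral_sq (hw : MemSeqSpace a w) :
    Summable fun n : ℤ => ∫ x in ball (0 : Space) a, ‖w n x‖ ^ 2 := by
  refine Summable.of_nonneg_of_le (fun n => integral_nonneg fun x => sq_nonneg _) (fun n => ?_) hw.2
  refine le_mul_of_one_le_left (integral_nonneg fun x => sq_nonneg _) ?_
  exact Real.one_le_rpow (by linarith [abs_nonneg (n : ℝ)]) (by norm_num)

lemma memLp_forcing_mul (hΩ : IsForcing ω Ω) {o : ℤ → ℝ}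
    (hb : ∀ᵐ x : Space, ∀ j, ‖Ω j x‖ ≤ o j) (hw : MemSeqSpace a w) (j k : ℤ) :
    MemLp (fun x => Ω j x * w k x) 2 (volume.restrict (ball (0 : Space) a)) := by
  refine (hw.1 k).of_le_mul (c := o j) ((hΩ.aestronglyMeasurable j).restrict.mul (hw.1 k).1) ?_
  filter_upwards [ae_restrict_of_ae hb] with x hx
  rw [norm_mul]
  gcongr
  exact hx j

/-- The series converges absolutely in `L²` of the ball: its terms have norm at most `o j * √M`,
where `M` bounds all the `‖w k‖ ^ 2`. -/
lemma memLp_coupling (hΩ : IsForcing ω Ω) (hw : MemSeqSpace a w) (n : ℤ) :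
    MemLp (coupling Ω w n) 2 (volume.restrict (ball (0 : Space) a)) := by
  obtain ⟨o, ho0, ho, hb⟩ := hΩ.exists_bound
  set μ := (volume : Measure Space).restrict (ball (0 : Space) a) with hμ
  set f : ℤ → Lp ℂ 2 μ := fun j => (memLp_forcing_mul hΩ hb hw j (n - j)).toLp with hf
  obtain ⟨M, hM⟩ : ∃ M, ∀ k, ∫ x, ‖w k x‖ ^ 2 ∂μ ≤ M :=
    ⟨_, fun k => hw.summable_integral_sq.le_tsum k
      fun j _ => integral_nonneg fun x => sq_nonneg _⟩
  have hfn : ∀ j, ‖f j‖ ≤ o j * √M := by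
    intro j
    rw [hf]
    simp only
    rw [Lp.norm_toLp]
    have h1 : eLpNorm (fun x => Ω j x * w (n - j) x) 2 μ
        ≤ ENNReal.ofReal (o j) * eLpNorm (w (n - j)) 2 μ := by
      refine eLpNorm_le_mul_eLpNorm_of_ae_le_mul ?_ 2
      filter_upwards [ae_restrict_of_ae hb] with x hx
      rw [norm_mul]
      gcongr
      exact hx j
    have h2 := ENNReal.toReal_mono
      (ENNReal.mul_ne_top ENNReal.ofReal_ne_top (hw.1 (n - j)).eLpNorm_ne_top) h1
    refine h2.trans ?_
    rw [ENNReal.toReal_mul, ENNReal.toReal_ofReal (ho0 j), ← sqrt_integral_norm_sq_eq (hw.1 (n - j))]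
    exact mul_le_mul_of_nonneg_left (Real.sqrt_le_sqrt (hM (n - j))) (ho0 j)
  have hsum : Summable fun j => ‖f j‖ :=
    Summable.of_nonneg_of_le (fun j => norm_nonneg _) hfn (ho.mul_right _)
  have htop : ∑' j, ‖f j‖ₑ ≠ ⊤ := tsum_enorm_ne_top_iff_summable_norm.2 hsum
  refine (Lp.memLp (∑' j, f j)).ae_eq ((Lp.coeFn_tsum htop).trans ?_)
  have hall : ∀ᵐ x ∂μ, ∀ j, f j x = Ω j x * w (n - j) x :=
    ae_all_iff.2 fun j => (memLp_forcing_mul hΩ hb hw j (n - j)).coeFn_toLp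
  filter_upwards [hall] with x hx
  simp_rw [hx]
  rfl

/-- The total energy flux generated by a real forcing vanishes. -/
lemma hasSum_coupling_flux (hω : 0 < ω) (hΩ : IsForcing ω Ω) (hw : MemSeqSpace a w) :
    HasSum (fun n : ℤ => (∫ x in ball (0 : Space) a, conj (w n x) * coupling Ω w n x).im) 0 := by
  obtain ⟨o, ho0, ho, hb⟩ := hΩ.exists_bound
  set μ := (volume : Measure Space).restrict (ball (0 : Space) a) with hμ
  set N : ℤ → ℝ := fun n => ∫ x, ‖w n x‖ ^ 2 ∂μ with hN
  have hNs : Summable N := hw.summable_integral_sq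
  have hN0 : ∀ n, 0 ≤ N n := fun n => integral_nonneg fun x => sq_nonneg _
  have hsq : ∀ n, Integrable (fun x => ‖w n x‖ ^ 2) μ := fun n =>
    (memLp_two_iff_integrable_sq_norm (hw.1 n).1).1 (hw.1 n)
  set f : ℤ → ℤ → Space → ℂ := fun n j x => conj (w n x) * (Ω j x * w (n - j) x) with hf
  have hfi : ∀ n j, Integrable (f n j) μ := fun n j =>
    ((hw.1 n).star).integrable_mul (memLp_forcing_mul hΩ hb hw j (n - j))
  -- The inequality `2 x y ≤ x ^ 2 + y ^ 2` separates the indices: each half is a product of two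
  -- summable families, the second after the shear `(n, j) ↦ (n - j, j)`.
  set bd : ℤ → ℤ → ℝ := fun n j => (N n * o j + N (n - j) * o j) / 2 with hbd
  have hfb : ∀ n j, ∫ x, ‖f n j x‖ ∂μ ≤ bd n j := by
    intro n j
    have h1 : ∫ x, ‖f n j x‖ ∂μ ≤ ∫ x, o j / 2 * (‖w n x‖ ^ 2 + ‖w (n - j) x‖ ^ 2) ∂μ := by
      refine integral_mono_ae (hfi n j).norm (((hsq n).add (hsq (n - j))).const_mul _) ?_
      filter_upwards [ae_restrict_of_ae hb] with x hx
      simp only [hf, norm_mul, RCLike.norm_conj]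
      calc ‖w n x‖ * (‖Ω j x‖ * ‖w (n - j) x‖) ≤ ‖w n x‖ * (o j * ‖w (n - j) x‖) := by
            gcongr
            exact hx j
        _ = o j * (‖w n x‖ * ‖w (n - j) x‖) := by ring
        _ ≤ o j * ((‖w n x‖ ^ 2 + ‖w (n - j) x‖ ^ 2) / 2) := by
            refine mul_le_mul_of_nonneg_left ?_ (ho0 j)
            nlinarith [sq_nonneg (‖w n x‖ - ‖w (n - j) x‖)]
        _ = _ := by ring
    refine h1.trans (le_of_eq ?_)
    rw [integral_const_mul, integral_add (hsq n) (hsq (n - j))]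
    simp only [hbd, hN]
    ring
  have hbs : Summable fun p : ℤ × ℤ => bd p.1 p.2 := by
    have h1 : Summable fun p : ℤ × ℤ => N p.1 * o p.2 := hNs.mul_of_nonneg ho hN0 ho0
    let E : ℤ × ℤ ≃ ℤ × ℤ :=
      { toFun := fun p => (p.1 - p.2, p.2)
        invFun := fun p => (p.1 + p.2, p.2)
        left_inv := fun p => by simp
        right_inv := fun p => by simp }
    have h2 : Summable fun p : ℤ × ℤ => N (p.1 - p.2) * o p.2 := (E.summable_iff).2 h1
    exact (h1.add h2).div_const 2
  set G : ℤ × ℤ → ℂ := fun p => ∫ x, f p.1 p.2 x ∂μ with hG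
  have hGs : Summable G := Summable.of_norm_bounded hbs fun p =>
    (norm_integral_le_integral_norm _).trans (hfb p.1 p.2)
  have hfib : ∀ n, ∫ x, conj (w n x) * coupling Ω w n x ∂μ = ∑' j, G (n, j) := by
    intro n
    have hs : Summable fun j => ∫ x, ‖f n j x‖ ∂μ :=
      Summable.of_nonneg_of_le (fun j => integral_nonneg fun x => norm_nonneg _) (hfb n)
        (hbs.comp_injective (i := fun j : ℤ => (n, j)) fun i j h => (Prod.ext_iff.1 h).2)
    rw [show ∑' j, G (n, j) = _ from integral_tsum_of_summable_integral_norm (hfi n) hs]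
    refine integral_congr_ae (Eventually.of_forall fun x => ?_)
    simp only [hf, coupling]
    rw [tsum_mul_left]
  have hsumn : HasSum (fun n => ∫ x, conj (w n x) * coupling Ω w n x ∂μ) (∑' p, G p) := by
    simp_rw [hfib]
    exact hGs.hasSum.prod_fiberwise fun n =>
      (hGs.comp_injective (i := fun j : ℤ => (n, j)) fun i j h => (Prod.ext_iff.1 h).2).hasSum
  -- The transition from `n - j` to `n` and its reverse contribute complex conjugates, so the
  -- involution `(n, j) ↦ (n - j, -j)` shows that the double sum is real.
  have hsymm : ∀ p : ℤ × ℤ, G (p.1 - p.2, -p.2) = conj (G p) := by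
    intro p
    simp only [hG]
    rw [← integral_conj]
    refine integral_congr_ae ?_
    filter_upwards [ae_restrict_of_ae (hΩ.ae_conj_symm hω)] with x hx
    simp only [hf, map_mul, Complex.conj_conj, hx, sub_neg_eq_add, sub_add_cancel]
    ring
  let S : ℤ × ℤ ≃ ℤ × ℤ :=
    { toFun := fun p => (p.1 - p.2, -p.2)
      invFun := fun p => (p.1 - p.2, -p.2)
      left_inv := fun p => by simp
      right_inv := fun p => by simp }
  have hreal : conj (∑' p, G p) = ∑' p, G p := by
    rw [Complex.conj_tsum, ← S.tsum_eq G]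
    exact tsum_congr fun p => (hsymm p).symm
  have h0 : (∑' p, G p).im = 0 := Complex.conj_eq_iff_im.1 hreal
  rw [← h0]
  exact Complex.hasSum_im hsumn

end Coupling

/-! ### Energy balance in each channel and the support conclusion. -/

section FloquetSystem

open scoped ComplexConjugate

variable {a b ω : ℝ} {Ω : ℤ → Space → ℂ}

lemma memLp_coupling_volume (ha : 1 < a) (hΩ : IsForcing ω Ω) {w : ℤ → Space → ℂ}
    (hw : MemSeqSpace a w) (n : ℤ) : MemLp (coupling Ω w n) 2 volume := by
  have h : (ball (0 : Space) a).indicator (coupling Ω w n) = coupling Ω w n := by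
    refine indicator_eq_self.2 fun x hx => ?_
    by_contra hxa
    rw [mem_ball_zero_iff, not_lt] at hxa
    exact hx (coupling_eq_zero hΩ w n (by linarith))
  rw [← h]
  exact (memLp_indicator_iff_restrict measurableSet_ball).2 (memLp_coupling hΩ hw n)

lemma ae_eq_indicator_of_ae_eq_zero {μ : Measure Space} (hμ : μ ≪ volume) {f : Space → ℂ}
    (h : ∀ᵐ x ∂μ, 1 < ‖x‖ → f x = 0) : f =ᵐ[μ] (ball (0 : Space) 1).indicator f := by
  filter_upwards [h, hμ.ae_le ae_norm_ne_one] with x hx hx1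
  rcases lt_or_gt_of_ne hx1 with hlt | hgt
  · rw [indicator_of_mem (mem_ball_zero_iff.2 hlt)]
  · rw [hx hgt, indicator_of_notMem]
    rw [mem_ball_zero_iff]
    linarith

/-- For `Re p₁ = 0` this quantity is the energy `κ` of the exterior equation in channel `n`; its
positivity is where `n < 0` and `Im p₁ < ω` enter. -/
lemma neg_energy_pos {p₁ : ℂ} (hω : 0 < ω) (him : p₁.im < ω) {n : ℤ} (hn : n < 0) :
    0 < -(p₁.im + n * ω) := by
  have : (n : ℝ) ≤ -1 := by exact_mod_cast Int.le_sub_one_of_lt hn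
  nlinarith

/-- Energy balance of the `n`-th channel of the differential system. -/
lemma SolvesHomogeneous.flux_eq {p₁ : ℂ} (ha : 1 < a) (hΩ : IsForcing ω Ω) {w : ℤ → LTwo}
    (hw : MemSeqSpace a fun n => (w n : Space → ℂ)) (hs : SolvesHomogeneous b ω Ω p₁ w) (n : ℤ) :
    (∫ x in ball (0 : Space) a, conj (w n x)
      * coupling Ω (fun m => (w m : Space → ℂ)) n x).im = p₁.re * ‖w n‖ ^ 2 := by
  obtain ⟨h, hh, heq⟩ := hs n
  set C : Space → ℂ := coupling Ω (fun m => (w m : Space → ℂ)) n with hC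
  set lam : ℂ := -Complex.I * p₁ + n * ω with hlam
  have hCL : MemLp C 2 volume := memLp_coupling_volume ha hΩ hw n
  have hwL : MemLp (w n) 2 volume := Lp.memLp (w n)
  have hae : ∀ᵐ x, h x = -C x - lam * w n x := by
    filter_upwards [heq] with x hx
    rw [← hx]
    ring
  have hhL : MemLp h 2 volume := by
    refine (hCL.neg.sub (hwL.const_mul lam)).ae_eq ?_
    filter_upwards [hae] with x hx
    simp [hx]
  have hcw : MemLp (fun x => conj (w n x)) 2 volume := hwL.star
  have i1 : Integrable fun x => conj (w n x) * C x := hcw.integrable_mul hCL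
  have i2 : Integrable fun x => conj (w n x) * w n x := hcw.integrable_mul hwL
  have hball : ∫ x in ball (0 : Space) a, conj (w n x) * C x = ∫ x, conj (w n x) * C x := by
    refine setIntegral_eq_integral_of_forall_compl_eq_zero fun x hx => ?_
    rw [mem_ball_zero_iff, not_lt] at hx
    rw [hC, coupling_eq_zero hΩ _ n (by linarith), mul_zero]
  have hn : ∫ x, conj (w n x) * w n x = ((‖w n‖ ^ 2 : ℝ) : ℂ) := by
    rw [← integral_norm_sq_Lp, ← integral_complex_ofReal]
    refine integral_congr_ae (Eventually.of_forall fun x => ?_)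
    simp [Complex.conj_mul']
  have hmain : ∫ x, conj (w n x) * h x
      = -(∫ x, conj (w n x) * C x) - lam * ((‖w n‖ ^ 2 : ℝ) : ℂ) := by
    have i1' : Integrable fun x => -(conj (w n x) * C x) := i1.neg
    rw [← hn, ← integral_const_mul, ← integral_neg, ← integral_sub i1' (i2.const_mul lam)]
    refine integral_congr_ae ?_
    filter_upwards [hae] with x hx
    rw [hx]
    ring
  have him := hh.integral_conj_mul_im hhL
  rw [hmain, Complex.sub_im, Complex.neg_im, Complex.im_mul_ofReal] at him
  have hlamim : lam.im = -p₁.re := by simp [hlam]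
  rw [hlamim] at him
  rw [hball]
  linarith

/-- Solutions of the differential system are supported in the unit ball in the channels of
negative index. -/
lemma SolvesHomogeneous.ae_eq_indicator {p₁ : ℂ} (hb : 0 < b) (hω : 0 < ω) (hΩ : IsForcing ω Ω)
    (hre : 0 ≤ p₁.re) (him : p₁.im < ω) (ha : 1 < a) {w : ℤ → LTwo}
    (hw : MemSeqSpace a fun n => (w n : Space → ℂ)) (hs : SolvesHomogeneous b ω Ω p₁ w)
    {n : ℤ} (hn : n < 0) :
    (w n : Space → ℂ) =ᵐ[volume] (ball (0 : Space) 1).indicator (w n) := by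
  refine ae_eq_indicator_of_ae_eq_zero Measure.AbsolutelyContinuous.rfl ?_
  have hflux := hasSum_coupling_flux hω hΩ hw
  simp_rw [hs.flux_eq ha hΩ hw] at hflux
  -- A sum of nonnegative terms that equals zero: no channel carries flux.
  have hzero := congrFun ((hasSum_zero_iff_of_nonneg fun n => by positivity).1 hflux) n
  rcases hre.lt_or_eq with hpos | hre0
  · have hwn : w n = 0 := by simpa [hpos.ne'] using hzero
    filter_upwards [Lp.coeFn_zero ℂ 2 (volume : Measure Space)] with x hx _
    rw [hwn, hx]
    rfl
  · obtain ⟨h, ⟨-, g, hg, hgh⟩, heq⟩ := hs n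
    refine ae_eq_zero_of_exterior_helmholtz hb.le (neg_energy_pos hω him hn) hg ?_
    filter_upwards [hgh, heq] with x hx hx2 hx1
    rw [coupling_eq_zero hΩ _ n hx1, neg_zero, hx] at hx2
    have hp : p₁ = Complex.I * p₁.im := by
      apply Complex.ext <;> simp [← hre0]
    have hI : -Complex.I * p₁ = p₁.im := by
      rw [hp]
      simp only [Complex.mul_im, Complex.I_re, Complex.I_im, Complex.ofReal_im, Complex.ofReal_re]
      rw [← mul_assoc, neg_mul, Complex.I_mul_I]
      simp
    rw [hI] at hx2
    push_cast at hx2 ⊢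
    linear_combination -hx2

/-- Energy balance for the regularized resolvent equation. -/
lemma resolvent_energy_balance {β δ : ℝ} {p : ℂ} {u : LTwo} {w C : Space → ℂ} {h : Space → ℂ}
    (hw : MemLp w 2 (volume.restrict (ball (0 : Space) a)))
    (hC : MemLp C 2 (volume.restrict (ball (0 : Space) a)))
    (hu : HasCoulombImage b u h)
    (heq : ∀ᵐ x : Space, h x - Complex.I * β * (ball (0 : Space) a).indicator u x
      - Complex.I * (p + δ) * u x
        = (ball (0 : Space) a).indicator (fun x => -Complex.I * β * w x - C x) x) :
    (p.re + δ) * ‖u‖ ^ 2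
      = β * ((∫ x in ball (0 : Space) a, conj (u x) * w x).re
          - (∫ x in ball (0 : Space) a, conj (u x) * u x).re)
        + (∫ x in ball (0 : Space) a, conj (u x) * C x).im := by
  set B : Set Space := ball (0 : Space) a with hB
  have hBm : MeasurableSet B := measurableSet_ball
  have huL : MemLp u 2 volume := Lp.memLp u
  have huB : MemLp u 2 (volume.restrict B) := huL.restrict B
  set F : Space → ℂ := fun x => -Complex.I * β * w x - C x + Complex.I * β * u x with hF
  have hFB : MemLp F 2 (volume.restrict B) :=
    ((hw.const_mul _).sub hC).add (huB.const_mul _)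
  have hFL : MemLp (B.indicator F) 2 volume := (memLp_indicator_iff_restrict hBm).2 hFB
  have hae : ∀ᵐ x, h x = B.indicator F x + Complex.I * (p + δ) * u x := by
    filter_upwards [heq] with x hx
    by_cases hxB : x ∈ B
    · simp only [indicator_of_mem hxB] at hx ⊢
      rw [hF]
      linear_combination hx
    · simp only [indicator_of_notMem hxB] at hx ⊢
      linear_combination hx
  have hhL : MemLp h 2 volume := by
    refine (hFL.add (huL.const_mul (Complex.I * (p + δ)))).ae_eq ?_
    filter_upwards [hae] with x hx
    simp [hx]
  have hcu : MemLp (fun x => conj (u x)) 2 volume := huL.star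
  have hcuB : MemLp (fun x => conj (u x)) 2 (volume.restrict B) := hcu.restrict B
  have i1 : Integrable fun x => conj (u x) * B.indicator F x := hcu.integrable_mul hFL
  have i2 : Integrable fun x => conj (u x) * u x := hcu.integrable_mul huL
  have j1 : Integrable (fun x => conj (u x) * w x) (volume.restrict B) := hcuB.integrable_mul hw
  have j2 : Integrable (fun x => conj (u x) * C x) (volume.restrict B) := hcuB.integrable_mul hC
  have j3 : Integrable (fun x => conj (u x) * u x) (volume.restrict B) := hcuB.integrable_mul huB
  have hn : ∫ x, conj (u x) * u x = ((‖u‖ ^ 2 : ℝ) : ℂ) := by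
    rw [← integral_norm_sq_Lp, ← integral_complex_ofReal]
    refine integral_congr_ae (Eventually.of_forall fun x => ?_)
    simp [Complex.conj_mul']
  have hind : ∫ x, conj (u x) * B.indicator F x
      = -Complex.I * β * (∫ x in B, conj (u x) * w x) - (∫ x in B, conj (u x) * C x)
        + Complex.I * β * ∫ x in B, conj (u x) * u x := by
    have : ∀ x, conj (u x) * B.indicator F x = B.indicator (fun x => conj (u x) * F x) x := by
      intro x
      by_cases hxB : x ∈ B <;> simp [hxB]
    simp_rw [this]
    have k1 := j1.const_mul (-Complex.I * β)
    have k3 := j3.const_mul (Complex.I * β)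
    have k12 : Integrable (fun x => -Complex.I * β * (conj (u x) * w x) - conj (u x) * C x)
      (volume.restrict B) := k1.sub j2
    rw [integral_indicator hBm, ← integral_const_mul, ← integral_const_mul, ← integral_sub k1 j2,
      ← integral_add k12 k3]
    refine integral_congr_ae (Eventually.of_forall fun x => ?_)
    simp only [hF]
    ring
  have hmain : ∫ x, conj (u x) * h x = (∫ x, conj (u x) * B.indicator F x)
      + Complex.I * (p + δ) * ((‖u‖ ^ 2 : ℝ) : ℂ) := by
    rw [← hn, ← integral_const_mul, ← integral_add i1 (i2.const_mul _)]
    refine integral_congr_ae ?_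
    filter_upwards [hae] with x hx
    rw [hx]
    ring
  have him := hu.integral_conj_mul_im hhL
  rw [hmain, hind, Complex.add_im, Complex.im_mul_ofReal, Complex.add_im, Complex.sub_im] at him
  have e1 : ∀ z : ℂ, (-Complex.I * β * z).im = -(β * z.re) := fun z => by simp
  have e2 : ∀ z : ℂ, (Complex.I * β * z).im = β * z.re := fun z => by simp
  have e3 : (Complex.I * (p + δ)).im = p.re + δ := by simp
  rw [e1, e2, e3] at him
  linarith

/-- In the limit of the truncated resolvent, the radiated energy equals the flux generated by the
coupling. -/
lemma tendsto_flux {β : ℝ} {p : ℂ} {w C : Space → ℂ}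
    (hw : MemLp w 2 (volume.restrict (ball (0 : Space) a)))
    (hC : MemLp C 2 (volume.restrict (ball (0 : Space) a))) {v : ℝ → LTwo}
    (hv : ∀ δ : ℝ, 0 < δ → ∃ h : Space → ℂ, HasCoulombImage b (v δ) h ∧
      ∀ᵐ x : Space, h x - Complex.I * β * (ball (0 : Space) a).indicator (v δ) x
        - Complex.I * (p + δ) * v δ x
          = (ball (0 : Space) a).indicator (fun x => -Complex.I * β * w x - C x) x)
    (hlim : Tendsto (fun δ : ℝ =>
        eLpNorm (fun x => v δ x - w x) 2 (volume.restrict (ball (0 : Space) a)))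
      (𝓝[>] 0) (𝓝 0)) :
    Tendsto (fun δ : ℝ => (p.re + δ) * ‖v δ‖ ^ 2) (𝓝[>] 0)
        (𝓝 (∫ x in ball (0 : Space) a, conj (w x) * C x).im) ∧
      Tendsto (fun δ : ℝ => (∫ x in ball (0 : Space) a, conj (v δ x) * v δ x).re) (𝓝[>] 0)
        (𝓝 (∫ x in ball (0 : Space) a, ‖w x‖ ^ 2)) := by
  set μ := (volume : Measure Space).restrict (ball (0 : Space) a) with hμ
  have hvm : ∀ δ, MemLp (v δ) 2 μ := fun δ => (Lp.memLp (v δ)).restrict _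
  set V : ℝ → Lp ℂ 2 μ := fun δ => (hvm δ).toLp with hV
  have hVW : Tendsto V (𝓝[>] 0) (𝓝 hw.toLp) :=
    (Lp.tendsto_Lp_iff_tendsto_eLpNorm'' _ hvm _ hw).2 hlim
  have hinner : ∀ {f g : Space → ℂ} (hf : MemLp f 2 μ) (hg : MemLp g 2 μ),
      (inner ℂ hf.toLp hg.toLp : ℂ) = ∫ x, conj (f x) * g x ∂μ := by
    intro f g hf hg
    rw [L2.inner_def]
    refine integral_congr_ae ?_
    filter_upwards [hf.coeFn_toLp, hg.coeFn_toLp] with x hx hy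
    rw [hx, hy]
    simp [mul_comm]
  have hX : Tendsto (fun δ => ∫ x, conj (v δ x) * w x ∂μ) (𝓝[>] 0)
      (𝓝 (∫ x, conj (w x) * w x ∂μ)) := by
    rw [← hinner hw hw]
    refine (hVW.inner tendsto_const_nhds).congr fun δ => hinner (hvm δ) hw
  have hY : Tendsto (fun δ => ∫ x, conj (v δ x) * C x ∂μ) (𝓝[>] 0)
      (𝓝 (∫ x, conj (w x) * C x ∂μ)) := by
    rw [← hinner hw hC]
    refine (hVW.inner tendsto_const_nhds).congr fun δ => hinner (hvm δ) hC
  have hZ : Tendsto (fun δ => ∫ x, conj (v δ x) * v δ x ∂μ) (𝓝[>] 0)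
      (𝓝 (∫ x, conj (w x) * w x ∂μ)) := by
    rw [← hinner hw hw]
    refine (hVW.inner hVW).congr fun δ => hinner (hvm δ) (hvm δ)
  have hww : (∫ x, conj (w x) * w x ∂μ).re = ∫ x, ‖w x‖ ^ 2 ∂μ := by
    have : ∫ x, conj (w x) * w x ∂μ = ((∫ x, ‖w x‖ ^ 2 ∂μ : ℝ) : ℂ) := by
      rw [← integral_complex_ofReal]
      refine integral_congr_ae (Eventually.of_forall fun x => ?_)
      simp [Complex.conj_mul']
    rw [this, Complex.ofReal_re]
  have hre := fun {f : ℝ → ℂ} {z : ℂ} (h : Tendsto f (𝓝[>] 0) (𝓝 z)) =>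
    (Complex.continuous_re.tendsto z).comp h
  refine ⟨?_, hww ▸ hre hZ⟩
  -- Both terms multiplied by `β` tend to the squared norm of `w` on the ball, so the artificial
  -- absorption drops out of the limit.
  have hsum := (((hre hX).sub (hre hZ)).const_mul β).add ((Complex.continuous_im.tendsto _).comp hY)
  rw [sub_self, mul_zero, zero_add] at hsum
  refine hsum.congr' ?_
  filter_upwards [self_mem_nhdsWithin] with δ hδ
  obtain ⟨h, hh, heq⟩ := hv δ hδ
  exact (resolvent_energy_balance hw hC hh heq).symm

/-- Solutions of the integral form of the system are supported in the unit ball in the channels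
of negative index. -/
lemma SolvesIntegralForm.ae_eq_indicator {p₁ : ℂ} (hb : 0 < b) (hω : 0 < ω)
    (hΩ : IsForcing ω Ω) (hre : 0 ≤ p₁.re) (him : p₁.im < ω) (ha : 1 < a) {ε pc c : ℝ}
    {w : ℤ → Space → ℂ} (hw : MemSeqSpace a w)
    (hs : SolvesIntegralForm b ω Ω p₁ a ε pc c w) {n : ℤ} (hn : n < 0) :
    w n =ᵐ[volume.restrict (ball (0 : Space) a)] (ball (0 : Space) 1).indicator (w n) := by
  have hpre : ∀ n : ℤ, (p₁ + Complex.I * n * ω).re = p₁.re := fun n => by simp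
  choose v hv hlim using hs
  have hT := fun n => tendsto_flux (hw.1 n) (memLp_coupling hΩ hw n) (hv n) (hlim n)
  simp_rw [hpre] at hT
  have hnonneg : ∀ n, 0 ≤ (∫ x in ball (0 : Space) a, conj (w n x) * coupling Ω w n x).im := by
    intro n
    refine ge_of_tendsto (hT n).1 ?_
    filter_upwards [self_mem_nhdsWithin] with δ hδ
    have hδ : 0 < δ := hδ
    positivity
  have hzero := congrFun ((hasSum_zero_iff_of_nonneg hnonneg).1 (hasSum_coupling_flux hω hΩ hw)) n
  obtain ⟨hflux, hnorm⟩ := hT n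
  rw [hzero] at hflux
  refine ae_eq_indicator_of_ae_eq_zero Measure.absolutelyContinuous_restrict ?_
  rcases hre.lt_or_eq with hpos | hre0
  -- Here the whole-space norm of `v n δ` is controlled by the flux divided by `Re p₁`, so `v n δ →
  -- 0`; as it also tends to `w n` on the ball, the latter is zero.
  · have hN : ∫ x in ball (0 : Space) a, ‖w n x‖ ^ 2 = 0 := by
      refine tendsto_nhds_unique hnorm ?_
      have hup : Tendsto (fun δ : ℝ => (p₁.re)⁻¹ * ((p₁.re + δ) * ‖v n δ‖ ^ 2)) (𝓝[>] 0) (𝓝 0) := by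
        simpa using hflux.const_mul (p₁.re)⁻¹
      have heq : ∀ δ, (∫ x in ball (0 : Space) a, conj (v n δ x) * v n δ x).re
          = ∫ x in ball (0 : Space) a, ‖v n δ x‖ ^ 2 := by
        intro δ
        have : ∫ x in ball (0 : Space) a, conj (v n δ x) * v n δ x
            = ((∫ x in ball (0 : Space) a, ‖v n δ x‖ ^ 2 : ℝ) : ℂ) := by
          rw [← integral_complex_ofReal]
          refine integral_congr_ae (Eventually.of_forall fun x => ?_)
          simp [Complex.conj_mul']
        rw [this, Complex.ofReal_re]
      simp_rw [heq]
      refine squeeze_zero' (Eventually.of_forall fun δ => integral_nonneg fun x => sq_nonneg _) ?_ hup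
      filter_upwards [self_mem_nhdsWithin] with δ hδ
      have hδ : 0 < δ := hδ
      have h1 : ∫ x in ball (0 : Space) a, ‖v n δ x‖ ^ 2 ≤ ‖v n δ‖ ^ 2 := by
        rw [← integral_norm_sq_Lp]
        exact setIntegral_le_integral
          ((memLp_two_iff_integrable_sq_norm (Lp.memLp (v n δ)).1).1 (Lp.memLp (v n δ)))
          (Eventually.of_forall fun x => sq_nonneg _)
      rw [inv_mul_eq_div, le_div_iff₀ hpos]
      nlinarith [sq_nonneg ‖v n δ‖]
    have hint := (memLp_two_iff_integrable_sq_norm (hw.1 n).1).1 (hw.1 n)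
    have h0 := (integral_eq_zero_iff_of_nonneg (fun x => sq_nonneg _) hint).1 hN
    filter_upwards [h0] with x hx _
    simpa using hx
  · rw [ae_restrict_iff' measurableSet_ball]
    set β := betaCut ε pc c (p₁ + Complex.I * n * ω) with hβ
    -- Outside the unit ball the coupling is absent. The absorption and its compensation combine
    -- into the source `-i β (v - w)` on the ball, which tends to zero there. For `δ ≤ 0` the value
    -- of `g` is irrelevant.
    have hg : ∀ δ, ∃ g : LTwo, 0 < δ → Δ (v n δ : 𝓢'(Space, ℂ)) = (g : 𝓢'(Space, ℂ)) ∧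
        ∀ᵐ x : Space, 1 < ‖x‖ →
          g x + ((b / ‖x‖ + -(p₁.im + n * ω) : ℝ) : ℂ) * v n δ x
            = (ball (0 : Space) a).indicator (fun x => (-Complex.I * β) * (v n δ x - w n x)) x
              - Complex.I * δ * v n δ x := by
      intro δ
      by_cases hδ : 0 < δ
      · obtain ⟨h, ⟨-, g, hg, hgh⟩, heq⟩ := hv n δ hδ
        refine ⟨g, fun _ => ⟨hg, ?_⟩⟩
        filter_upwards [hgh, heq] with x hx hx2 hx1
        have hp : -(Complex.I * (p₁ + Complex.I * n * ω)) = p₁.im + n * ω := by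
          have hp1 : p₁ = Complex.I * p₁.im := by
            apply Complex.ext <;> simp [← hre0]
          rw [hp1]
          simp only [Complex.mul_im, Complex.I_re, Complex.I_im, Complex.ofReal_im,
            Complex.ofReal_re, zero_mul, one_mul, zero_add]
          linear_combination (-(p₁.im : ℂ) - n * ω) * Complex.I_mul_I
        by_cases hxB : x ∈ ball (0 : Space) a
        · simp only [indicator_of_mem hxB, coupling_eq_zero hΩ w n hx1] at hx2 ⊢
          rw [hx] at hx2
          push_cast at hx2 ⊢
          linear_combination -hx2 + v n δ x * hp
        · simp only [indicator_of_notMem hxB] at hx2 ⊢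
          rw [hx] at hx2
          push_cast at hx2 ⊢
          linear_combination -hx2 + v n δ x * hp
      · exact ⟨0, fun h => absurd h hδ⟩
    choose g hg using hg
    rw [← hre0] at hflux
    simp only [zero_add] at hflux
    exact ae_eq_zero_on_shell_of_no_flux hb.le (neg_energy_pos hω him hn) (by linarith) (hw.1 n)
      (-Complex.I * β) (fun δ hδ => (hg δ hδ).1) (fun δ hδ => (hg δ hδ).2) (hlim n) hflux

end FloquetSystem

theorem theorem3 (b ω : ℝ) (hb : 0 < b) (hω : 0 < ω)
    (Ω : ℤ → Space → ℂ) (hΩ : IsForcing ω Ω)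
    (p₁ : ℂ) (hre : 0 ≤ p₁.re) (him : p₁.im < ω)
    (a : ℝ) (ha : 1 < a) :
    -- solutions in `H²(ℝ³)` of the differential system, decaying in `n`
    (∀ w : ℤ → LTwo,
      MemSeqSpace a (fun n => (w n : Space → ℂ)) →
      SolvesHomogeneous b ω Ω p₁ w →
      (∃ n : ℤ, w n ≠ 0) →
      ∀ n : ℤ, n < 0 →
        (w n : Space → ℂ) =ᵐ[volume] (ball (0 : Space) 1).indicator (w n)) ∧
    -- solutions on `B_a` of the integral form of the system
    (∀ ε pc c : ℝ, 0 < ε → ε < ω / 2 → b ^ 2 / 4 < pc → (∀ k : ℤ, pc / ω ≠ k) → 0 < c →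
      ∀ w : ℤ → Space → ℂ,
        MemSeqSpace a w →
        SolvesIntegralForm b ω Ω p₁ a ε pc c w →
        (∃ n : ℤ, ¬ w n =ᵐ[volume.restrict (ball (0 : Space) a)] 0) →
        ∀ n : ℤ, n < 0 →
          w n =ᵐ[volume.restrict (ball (0 : Space) a)] (ball (0 : Space) 1).indicator (w n)) := by
  exact ⟨fun w hw hs _ n hn => hs.ae_eq_indicator hb hω hΩ hre him ha hw hn,
    fun ε pc c _ _ _ _ _ w hw hs _ n hn => hs.ae_eq_indicator hb hω hΩ hre him ha hw hn⟩
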